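/- \textbf{Notation.} Let $p$ be a prime, $\rho_p=\frac1{p-1}$. For $y\in\mathbb{Q}_{>0}$ put $\iota(y)=\max(0,\operatorname{ord}_p(y^{-1}))$, $\iota'(y)=\max(0,\operatorname{ord}_p y)$, and $\rho_p(y)=\rho_p$ if $\operatorname{ord}_py\neq0$, $\rho_p(y)=0$ otherwise. Let $e(x)=e^{2\pi i x}$ on $\mathbb{Z}[1/p]$, extended to a $\mathbb{Z}_p$-periodic function on $\mathbb{Q}_p=\mathbb{Z}[1/p]+\mathbb{Z}_p$. Let $\mathbf{I}_0(\mathbb{Z}_p)$ be the set of power series $\sum_{k\ge0} a_kt^k$ with $a_k\in\mathbb{Z}_p$, $|a_k|_p\to0$, and $\mathbf{I}_0[\lambda](\mathbb{Z}_p)$ the subset of those with $\operatorname{ord}_pa_k\ge\lceil k\lambda\rceil$ for all $k\geq 0$. For $w\in\mathbb{Z}$, integers $u,\kappa\geq 1$ with $\kappa\ge 1+\iota'(2)$, $\lambda\in\{\rho_p,2\rho_p,3\rho_p,\dots\}$, $y\in\mathbb{Q}_{>0}$ and $\omega,\omega'\in\mathbb{Z}_p^\times$, the class $\mathbf{F}(w,y,\kappa,\lambda,u,\omega,\omega')$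 consists of the power series $f\in\mathbb{Q}_p^\times\mathbf{I}_0(\mathbb{Z}_p)$ such that $$f'(t)=p^w\omega'\bigl(1+p^{\iota(y)+\kappa}\omega t\bigr)^{-y}+p^w\gamma_0+p^{u+w}g(t)$$ for some $\gamma_0\in\mathbb{Z}_p$ and $g\in\mathbf{I}_0[\lambda](\mathbb{Z}_p)$, where $(1+ct)^{-y}=\sum_{k\ge0}\binom{-y}{k}c^kt^k$. \textbf{Theorem (Summation Formula).} Let $f\in\mathbf{F}(w,y,\kappa,\lambda,u,\omega,\omega')$, write $\iota'=\iota'(y)$, and assume $$\kappa\ge1+\iota'(4),\qquad u+\lfloor\lambda\rfloor>\kappa+\iota',\qquad \tilde\lambda=\min(\kappa-\rho_p(y),\lambda)>0 .$$ Let $\varepsilon_\lambda=\lfloor\lambda\rfloor-\lceil\tilde\lambda\rceil$. Then there exists a power series $$\mathring f\in\mathbf{F}\bigl(w+\operatorname{ord}_py,\;y^{-1},\;\kappa,\;\tilde\lambda,\;u+\varepsilon_\lambda-\operatorname{ord}_py,\;\omega'^{-1},\;-\omega^{-1}\bigr),$$ depending only on $f$, with the following property. For every positive integer $n$ with $n-w>\kappa+\iota'+\iota'(12)$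 there is $\epsilon\in\mathbb{C}$ with $|\epsilon|=1$ such that, for every real $B>0$, every Schwartz function $h:\mathbb{R}\to\mathbb{C}$, and every $a\in\mathbb{Z}[1/p]$ with $a\equiv f'(0)\pmod{p^n\mathbb{Z}_p}$, $$\sum_{m\in\mathbb{Z}}e\Bigl(\frac{f(m)}{p^n}\Bigr)h\Bigl(\frac mB\Bigr)=\frac{\epsilon B}{p^{(n-w-\iota'-\kappa)/2}}\sum_{t\in\mathbb{Z}}e\Bigl(\frac{\mathring f(t)}{p^n}\Bigr)\hat h_{f,B}\Bigl(\frac{t}{p^{n-w-\iota'-\kappa}/B}\Bigr),$$ both series being absolutely convergent, where $$\hat h_{f,B}(t)=\hat h\Bigl(-t-\frac{a}{p^n/B}\Bigr),\qquad \hat h(\xi)=\int_{\mathbb{R}}h(x)e^{-2\pi i x\xi}\,dx .$$ -/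

import Mathlib

open scoped PowerSeries SchwartzMap FourierTransform

noncomputable section

namespace PadicPhase

/-- `ι(y) = max(0, ord_p(y⁻¹))`. -/
def iota (p : ℕ) (y : ℚ) : ℤ := max 0 (padicValRat p y⁻¹)

/-- `ι'(y) = max(0, ord_p y)`. -/
def iota' (p : ℕ) (y : ℚ) : ℤ := max 0 (padicValRat p y)

/-- `ρ_p = 1/(p-1)`. -/
def rho (p : ℕ) : ℝ := 1 / ((p : ℝ) - 1)

/-- `ρ_p(y)`, which is `ρ_p` if `ord_p y ≠ 0` and `0` otherwise. -/
def rhoY (p : ℕ) (y : ℚ) : ℝ := if padicValRat p y = 0 then 0 else rho p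

/-- `λ̃ = min(κ - ρ_p(y), λ)`. -/
def lamTilde (p : ℕ) (y : ℚ) (κ : ℕ) (lam : ℝ) : ℝ := min ((κ : ℝ) - rhoY p y) lam

/-- `x` is an element of `ℤ[1/p]`, the union of all `p^k ℤ`. -/
def IsPFraction (p : ℕ) (x : ℚ) : Prop := ∃ (m : ℤ) (k : ℕ), x = (m : ℚ) / (p : ℚ) ^ k

variable (p : ℕ) [Fact p.Prime]

/-- `ℚ_p = ℤ[1/p] + ℤ_p`. -/
theorem exists_pFraction (x : ℚ_[p]) :
    ∃ r : ℚ, IsPFraction p r ∧ ‖x - (r : ℚ_[p])‖ ≤ 1 := by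
  have hp1 : (1 : ℝ) < p := by exact_mod_cast (Fact.out : p.Prime).one_lt
  have hp0 : (p : ℚ_[p]) ≠ 0 := by exact_mod_cast (Fact.out : p.Prime).ne_zero
  obtain ⟨k, hk⟩ := pow_unbounded_of_one_lt ‖x‖ hp1
  have hpk : (0 : ℝ) < (p : ℝ) ^ k := by positivity
  have hz : ‖x * (p : ℚ_[p]) ^ k‖ ≤ 1 := by
    rw [norm_mul, norm_pow, Padic.norm_p, inv_pow, ← div_eq_mul_inv, div_le_one hpk]
    exact hk.le
  obtain ⟨z, hzx⟩ : ∃ z : ℤ_[p], (z : ℚ_[p]) = x * (p : ℚ_[p]) ^ k := ⟨⟨_, hz⟩, rfl⟩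
  obtain ⟨m, hm⟩ := PadicInt.denseRange_intCast.exists_dist_lt z (inv_pos.mpr hpk)
  rw [dist_eq_norm, PadicInt.norm_def] at hm
  refine ⟨(m : ℚ) / (p : ℚ) ^ k, ⟨m, k, rfl⟩, ?_⟩
  have e : x - (((m : ℚ) / (p : ℚ) ^ k : ℚ) : ℚ_[p])
      = (x * (p : ℚ_[p]) ^ k - (m : ℚ_[p])) / (p : ℚ_[p]) ^ k := by
    push_cast
    field_simp
  have hm' : ‖x * (p : ℚ_[p]) ^ k - (m : ℚ_[p])‖ < ((p : ℝ) ^ k)⁻¹ := by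
    rw [← hzx]
    simpa using hm
  rw [e, norm_div, norm_pow, Padic.norm_p, inv_pow, div_inv_eq_mul]
  calc _ ≤ ((p : ℝ) ^ k)⁻¹ * (p : ℝ) ^ k := by gcongr
    _ = 1 := inv_mul_cancel₀ hpk.ne'

/-- The `ℤ_p`-periodic extension to `ℚ_p` of the function `e(r) = exp(2πir)` on `ℤ[1/p]`. -/
def eP (x : ℚ_[p]) : ℂ :=
  Complex.exp (2 * Real.pi * Complex.I * ((exists_pFraction p x).choose : ℂ))

theorem isPFraction_int {p : ℕ} [Fact p.Prime] {r : ℚ} (hr : IsPFraction p r)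
    (h : ‖(r : ℚ_[p])‖ ≤ 1) : ∃ m : ℤ, r = m := by
  obtain ⟨m, k, rfl⟩ := hr
  have hp : (p : ℚ) ≠ 0 := by exact_mod_cast (Fact.out : p.Prime).ne_zero
  have hpk : (0 : ℝ) < (p : ℝ) ^ k := by
    have : (0 : ℝ) < p := by exact_mod_cast (Fact.out : p.Prime).pos
    positivity
  push_cast at h
  rw [norm_div, norm_pow, Padic.norm_p, inv_pow, div_inv_eq_mul, ← le_div_iff₀ hpk, one_div] at h
  have h2 : ((p ^ k : ℕ) : ℤ) ∣ m := by
    push_cast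
    rw [← Padic.norm_int_le_pow_iff_dvd]
    simpa [zpow_neg] using h
  obtain ⟨c, hc⟩ := h2
  refine ⟨c, ?_⟩
  rw [hc]
  push_cast
  field_simp

/-- The value `e(x)` does not depend on the representative of `x` in `ℤ[1/p]` modulo `ℤ_p`. -/
theorem eP_eq {x : ℚ_[p]} {r : ℚ} (hr : IsPFraction p r) (h : ‖x - (r : ℚ_[p])‖ ≤ 1) :
    eP p x = Complex.exp (2 * Real.pi * Complex.I * (r : ℂ)) := by
  have hp : (p : ℚ) ≠ 0 := by exact_mod_cast (Fact.out : p.Prime).ne_zero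
  obtain ⟨hr', h'⟩ := (exists_pFraction p x).choose_spec
  unfold eP
  set s := (exists_pFraction p x).choose
  have hd : IsPFraction p (s - r) := by
    obtain ⟨m, k, e1⟩ := hr
    obtain ⟨m', k', e2⟩ := hr'
    refine ⟨m' * p ^ k - m * p ^ k', k' + k, ?_⟩
    rw [e1, e2]
    push_cast
    field_simp
    ring
  have hn : ‖((s - r : ℚ) : ℚ_[p])‖ ≤ 1 := by
    have e : ((s - r : ℚ) : ℚ_[p]) = (x - (r : ℚ_[p])) - (x - (s : ℚ_[p])) := by
      push_cast; ring
    rw [e]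
    rw [sub_eq_add_neg]
    exact (Padic.nonarchimedean _ _).trans (max_le h (by rwa [norm_neg]))
  obtain ⟨m, hm⟩ := isPFraction_int hd hn
  have hs : s = r + m := by linarith
  rw [Complex.exp_eq_exp_iff_exists_int]
  refine ⟨m, ?_⟩
  rw [hs]
  push_cast
  ring

/-- `𝐈₀(ℤ_p)`: power series with coefficients in `ℤ_p` that tend to zero. -/
def I0 : Set ℚ_[p]⟦X⟧ :=
  {a | (∀ k, ‖PowerSeries.coeff k a‖ ≤ 1) ∧
    Filter.Tendsto (fun k => ‖PowerSeries.coeff k a‖) Filter.atTop (nhds 0)}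

/-- `𝐈₀[λ](ℤ_p)`: the series in `𝐈₀(ℤ_p)` whose coefficients satisfy `ord_p a_k ≥ ⌈kλ⌉`. -/
def I0Lam (lam : ℝ) : Set ℚ_[p]⟦X⟧ :=
  {a | a ∈ I0 p ∧ ∀ k : ℕ, ‖PowerSeries.coeff k a‖ ≤ (p : ℝ) ^ (-⌈(k : ℝ) * lam⌉)}

/-- The power series `(1 + c t)^y = ∑ binom(y, k) c^k t^k`. -/
def onePlusPow (c : ℚ_[p]) (y : ℚ) : ℚ_[p]⟦X⟧ :=
  PowerSeries.rescale c (PowerSeries.binomialSeries ℚ_[p] y)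

/-- The value at `x` of a `p`-adic power series. -/
def evalAt (f : ℚ_[p]⟦X⟧) (x : ℚ_[p]) : ℚ_[p] :=
  ∑' k : ℕ, PowerSeries.coeff k f * x ^ k

/-- `f` belongs to the class `𝐅(w, y, κ, λ, u, ω, ω')`; the admissibility of the parameters
is part of the definition. -/
structure InClassF (w : ℤ) (y : ℚ) (κ : ℕ) (lam : ℝ) (u : ℤ) (ω ω' : ℤ_[p]ˣ)
    (f : ℚ_[p]⟦X⟧) : Prop where
  y_pos : 0 < y
  kappa_ge : 1 + iota' p 2 ≤ (κ : ℤ)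
  u_pos : 0 < u
  lam_mem : ∃ k : ℕ, 0 < k ∧ lam = k * rho p
  series : ∃ c : ℚ_[p], c ≠ 0 ∧ ∃ a ∈ I0 p, f = PowerSeries.C c * a
  deriv : ∃ γ₀ : ℤ_[p], ∃ g ∈ I0Lam p lam,
    PowerSeries.derivative ℚ_[p] f =
      PowerSeries.C ((p : ℚ_[p]) ^ w * ((ω' : ℤ_[p]) : ℚ_[p])) *
          onePlusPow p ((p : ℚ_[p]) ^ (iota p y + (κ : ℤ)) * ((ω : ℤ_[p]) : ℚ_[p])) (-y)
        + PowerSeries.C ((p : ℚ_[p]) ^ w * (γ₀ : ℚ_[p]))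
        + PowerSeries.C ((p : ℚ_[p]) ^ (u + w)) * g

/-- `ĥ_{f,B}(t) = ĥ(-t - a/(p^n/B))`, where `a` stands for `f'(0)`. -/
def hHat (h : 𝓢(ℝ, ℂ)) (a : ℚ) (n : ℕ) (B : ℝ) (t : ℝ) : ℂ :=
  𝓕 (h : ℝ → ℂ) (-t - (a : ℝ) / ((p : ℝ) ^ n / B))

end PadicPhase

end

/-!
The derivative of `f` is normalised as `f' = f'(0) + p^v G` with `v = w + κ + ι'(y)`, where `G`
has no constant term and a unit linear coefficient. Let `φ` be the compositional inverse of `G`,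
and `∫` antidifferentiation without constant term. The dual series is `f(0) - p^v ∫ φ`; since
`p^{-v}` is the absolute value of `f''(0)`, it depends on `f` only (`dualSeries`).

*The summation formula.* Put `N = n - v`. The linear part `f'(0)m` of the phase combines with
`h(m/B)` into a shift of the argument of the Fourier transform of `h`, and what remains is the
weight `e(∫G(m)/p^N)`, which is periodic modulo `p^N`. Poisson summation with periodic weights
(`SchwartzMap.tsum_periodic_mul_eq`) reduces the formula to computing the complete sums
`S(t) = ∑ e((∫G(m) - tm)/p^N)` over `m` modulo `p^N`. These are evaluated by stationary phase
(`finiteFourier_stationaryPhase`). Averaging over translations of `m` by multiples of `p^{N-q}`,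
where `q` is about `N/2`, leaves only the `m` with `G(m) ≡ t` modulo `p^q`, that is, with
`m ≡ φ(t)`, because `G` is an isometry of `ℤ_p`. On this ball the phase is its value at `φ(t)`
plus a function of `m - φ(t)` independent of `t`, so that `S(t)` is a constant `K` times
`e((∫G(φ(t)) - tφ(t))/p^N)`. The constant is never computed: Parseval gives `|K|² = p^N`. By the
chain rule, the Legendre transform `∫G(φ(t)) - tφ(t)` is `-∫φ(t)` (`evalAt_legendre`), the dual
phase. Only the decay of the coefficients of `G` recorded in `TameCoeffs` enters here; it follows
from the lower bounds for `κ` and `u + ⌊λ⌋`, and the one for `n - w` leaves room for the small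
primes.

*The class of the dual series.* Here `G = P + E`, where `P = ((1 + ct)^{-y} - 1)/d` and `E` is
small in the Gauss norm of the disc of radius `p^λ̃`. The inverse of `P` is
`Q = ((1 + dt)^{-1/y} - 1)/c` (`binomialMap_subst_binomialMap`, by uniqueness for the differential
equation of a binomial series), and both `P` and `Q` preserve the disc; this is where
`λ̃ ≤ κ - ρ_p(y)` is needed. Since `P(φ) = X - E(φ)`, the difference `φ - Q = Q(X - E(φ)) - Q(X)`
is as small as `E` (`GaussBound.inverse_sub_inverse`). Thus the derivative `-p^v φ` of the dual
series is a binomial series plus a constant and an admissible error (`InClassF.dual`).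
-/

namespace PadicPhase

/-! ### The additive character of `ℚ_p` -/

section AdditiveCharacter

variable {p : ℕ} [Fact p.Prime]

theorem IsPFraction.add {r s : ℚ} (hr : IsPFraction p r) (hs : IsPFraction p s) :
    IsPFraction p (r + s) := by
  have hp : (p : ℚ) ≠ 0 := by exact_mod_cast (Fact.out : p.Prime).ne_zero
  obtain ⟨m, k, rfl⟩ := hr
  obtain ⟨m', k', rfl⟩ := hs
  refine ⟨m * p ^ k' + m' * p ^ k, k + k', ?_⟩
  push_cast
  field_simp
  ring

theorem IsPFraction.mul_int_div_pow {r : ℚ} (hr : IsPFraction p r) (m : ℤ) (n : ℕ) :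
    IsPFraction p (r * m / (p : ℚ) ^ n) := by
  have hp : (p : ℚ) ≠ 0 := by exact_mod_cast (Fact.out : p.Prime).ne_zero
  obtain ⟨m', k', rfl⟩ := hr
  refine ⟨m' * m, k' + n, ?_⟩
  push_cast
  field_simp
  ring

theorem eP_add (x y : ℚ_[p]) : eP p (x + y) = eP p x * eP p y := by
  obtain ⟨r, hr, h⟩ := exists_pFraction p x
  obtain ⟨s, hs, h'⟩ := exists_pFraction p y
  rw [eP_eq p hr h, eP_eq p hs h', eP_eq p (hr.add hs), ← Complex.exp_add]
  · push_cast; ring_nf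
  · have : x + y - ((r + s : ℚ) : ℚ_[p]) = (x - r) + (y - s) := by push_cast; ring
    rw [this]
    exact (Padic.nonarchimedean _ _).trans (max_le h h')

theorem eP_eq_one {x : ℚ_[p]} (h : ‖x‖ ≤ 1) : eP p x = 1 := by
  rw [eP_eq p (r := 0) ⟨0, 0, by simp⟩ (by simpa using h)]
  simp

theorem eP_eq_one_iff {x : ℚ_[p]} : eP p x = 1 ↔ ‖x‖ ≤ 1 := by
  refine ⟨fun h => ?_, eP_eq_one⟩
  obtain ⟨r, hr, h'⟩ := exists_pFraction p x
  rw [eP_eq p hr h', Complex.exp_eq_one_iff] at h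
  obtain ⟨n, hn⟩ := h
  have : (r : ℂ) = n := by
    have := Complex.two_pi_I_ne_zero
    apply mul_left_cancel₀ this
    rw [hn]; ring
  have hrn : r = n := by exact_mod_cast this
  have e : x = (x - r) + (r : ℚ_[p]) := by ring
  rw [e]
  refine (Padic.nonarchimedean _ _).trans (max_le h' ?_)
  rw [hrn]
  simpa using Padic.norm_int_le_one n

theorem norm_eP (x : ℚ_[p]) : ‖eP p x‖ = 1 := by
  unfold eP
  rw [show (2 * Real.pi * Complex.I * (((exists_pFraction p x).choose : ℚ) : ℂ) : ℂ)
    = ((2 * Real.pi * ((exists_pFraction p x).choose : ℚ) : ℝ) : ℂ) * Complex.I by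
      push_cast; ring]
  exact Complex.norm_exp_ofReal_mul_I _

theorem eP_congr {x y : ℚ_[p]} (h : ‖x - y‖ ≤ 1) : eP p x = eP p y := by
  have : x = (x - y) + y := by ring
  rw [this, eP_add, eP_eq_one h, one_mul]

theorem eP_zero : eP p 0 = 1 := eP_eq_one (by simp)

theorem eP_neg (x : ℚ_[p]) : eP p (-x) = (eP p x)⁻¹ := by
  apply eq_inv_of_mul_eq_one_left
  rw [← eP_add]
  simp [eP_zero]

theorem conj_eP (x : ℚ_[p]) : (starRingEnd ℂ) (eP p x) = eP p (-x) := by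
  rw [eP_neg, Complex.inv_def, Complex.normSq_eq_norm_sq, norm_eP]
  simp

theorem eP_nat_mul (n : ℕ) (x : ℚ_[p]) : eP p (n * x) = eP p x ^ n := by
  induction n with
  | zero => simp [eP_zero]
  | succ n ih => rw [pow_succ, ← ih, ← eP_add]; push_cast; ring_nf

theorem norm_div_pow_le_one_iff (x : ℚ_[p]) (n : ℕ) :
    ‖x / (p : ℚ_[p]) ^ n‖ ≤ 1 ↔ ‖x‖ ≤ (p : ℝ) ^ (-(n : ℤ)) := by
  have : (0 : ℝ) < (p : ℝ) ^ n := by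
    have : (0 : ℝ) < p := by exact_mod_cast (Fact.out : p.Prime).pos
    positivity
  rw [norm_div, norm_pow, Padic.norm_p, inv_pow, div_inv_eq_mul, ← le_div_iff₀ this, one_div,
    zpow_neg, zpow_natCast]

theorem eP_div_congr {x y : ℚ_[p]} {n : ℕ} (h : ‖x - y‖ ≤ (p : ℝ) ^ (-(n : ℤ))) :
    eP p (x / (p : ℚ_[p]) ^ n) = eP p (y / (p : ℚ_[p]) ^ n) := by
  apply eP_congr
  rw [← sub_div]
  exact (norm_div_pow_le_one_iff _ _).2 h

/-- Orthogonality of the characters `b ↦ e(bz/p^q)` of `ℤ/p^q`. -/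
theorem sum_eP_mul_div (q : ℕ) (z : ℤ_[p]) :
    ∑ b ∈ Finset.range (p ^ q), eP p ((b : ℚ_[p]) * (z : ℚ_[p]) / (p : ℚ_[p]) ^ q) =
      if ‖z‖ ≤ (p : ℝ) ^ (-(q : ℤ)) then (p : ℂ) ^ q else 0 := by
  have hp : (p : ℚ_[p]) ≠ 0 := by exact_mod_cast (Fact.out : p.Prime).ne_zero
  have e : ∀ b : ℕ, eP p ((b : ℚ_[p]) * (z : ℚ_[p]) / (p : ℚ_[p]) ^ q)
      = eP p ((z : ℚ_[p]) / (p : ℚ_[p]) ^ q) ^ b := by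
    intro b
    rw [← eP_nat_mul, mul_div_assoc]
  simp_rw [e]
  split_ifs with h
  · have : eP p ((z : ℚ_[p]) / (p : ℚ_[p]) ^ q) = 1 :=
      eP_eq_one ((norm_div_pow_le_one_iff _ _).2 h)
    simp [this]
  · have hne : eP p ((z : ℚ_[p]) / (p : ℚ_[p]) ^ q) ≠ 1 := by
      rw [Ne, eP_eq_one_iff, norm_div_pow_le_one_iff]
      exact h
    have h1 : eP p ((z : ℚ_[p]) / (p : ℚ_[p]) ^ q) ^ (p ^ q) = 1 := by
      rw [← eP_nat_mul]
      push_cast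
      rw [mul_div_cancel₀ _ (pow_ne_zero _ hp)]
      exact eP_eq_one z.2
    rw [geom_sum_eq hne, h1]
    simp

end AdditiveCharacter

/-! ### Complete exponential sums -/

section FiniteSums

variable {p : ℕ} [Fact p.Prime]

theorem norm_sub_appr_le (x : ℤ_[p]) (N : ℕ) :
    ‖x - (x.appr N : ℤ_[p])‖ ≤ (p : ℝ) ^ (-(N : ℤ)) :=
  (PadicInt.norm_le_pow_iff_mem_span_pow _ _).2 (PadicInt.appr_spec N x)

theorem natCast_eq_of_norm_sub_le {N a b : ℕ} (ha : a < p ^ N) (hb : b < p ^ N)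
    (h : ‖(a : ℤ_[p]) - b‖ ≤ (p : ℝ) ^ (-(N : ℤ))) : a = b := by
  have h2 : ((p ^ N : ℕ) : ℤ) ∣ (a : ℤ) - b := by
    push_cast
    rw [← PadicInt.norm_int_le_pow_iff_dvd]
    simpa using h
  have := (Nat.modEq_iff_dvd.2 h2).symm
  exact (Nat.ModEq.eq_of_lt_of_lt this ha hb)

theorem appr_eq_of_norm_sub_le {N a : ℕ} (ha : a < p ^ N) {x : ℤ_[p]}
    (h : ‖x - a‖ ≤ (p : ℝ) ^ (-(N : ℤ))) : x.appr N = a := by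
  refine natCast_eq_of_norm_sub_le (PadicInt.appr_lt x N) ha ?_
  have : (x.appr N : ℤ_[p]) - a = (x - a) - (x - x.appr N) := by ring
  rw [this, sub_eq_add_neg]
  refine (PadicInt.nonarchimedean _ _).trans (max_le h ?_)
  rw [norm_neg]
  exact norm_sub_appr_le x N

/-- A sum over residues modulo `p^N` is invariant under translation by a `p`-adic integer. -/
theorem sum_range_add_eq {N : ℕ} {F : ℤ_[p] → ℂ}
    (hF : ∀ x y, ‖x - y‖ ≤ (p : ℝ) ^ (-(N : ℤ)) → F x = F y) (z : ℤ_[p]) :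
    ∑ a ∈ Finset.range (p ^ N), F (a + z) = ∑ a ∈ Finset.range (p ^ N), F a := by
  refine Finset.sum_nbij' (fun a => ((a : ℤ_[p]) + z).appr N) (fun b => ((b : ℤ_[p]) - z).appr N)
    (fun a _ => Finset.mem_range.2 (PadicInt.appr_lt _ _))
    (fun a _ => Finset.mem_range.2 (PadicInt.appr_lt _ _)) ?_ ?_ ?_
  · intro a ha
    apply appr_eq_of_norm_sub_le (Finset.mem_range.1 ha)
    rw [← norm_neg]
    convert norm_sub_appr_le ((a : ℤ_[p]) + z) N using 1
    congr 1
    ring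
  · intro a ha
    apply appr_eq_of_norm_sub_le (Finset.mem_range.1 ha)
    rw [← norm_neg]
    convert norm_sub_appr_le ((a : ℤ_[p]) - z) N using 1
    congr 1
    ring
  · intro a _
    exact hF _ _ (norm_sub_appr_le _ _)

/-- The finite Fourier transform modulo `p^N` of the restriction to `ℤ` of `F : ℤ_p → ℂ`. -/
noncomputable def finiteFourier (N : ℕ) (F : ℤ_[p] → ℂ) (t : ℤ) : ℂ :=
  ∑ a ∈ Finset.range (p ^ N), F a * eP p (-((t : ℚ_[p]) * (a : ℚ_[p])) / (p : ℚ_[p]) ^ N)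

theorem finiteFourier_periodic (N : ℕ) (F : ℤ_[p] → ℂ) (t k : ℤ) :
    finiteFourier N F (t + (p ^ N : ℕ) * k) = finiteFourier N F t := by
  unfold finiteFourier
  refine Finset.sum_congr rfl fun a _ => ?_
  congr 1
  apply eP_div_congr
  have : -(((t + (p ^ N : ℕ) * k : ℤ) : ℚ_[p]) * (a : ℚ_[p])) - -((t : ℚ_[p]) * (a : ℚ_[p]))
    = ((-(k * a) : ℤ) : ℚ_[p]) * (p : ℚ_[p]) ^ N := by push_cast; ring
  rw [this, norm_mul, norm_pow, Padic.norm_p, inv_pow, zpow_neg, zpow_natCast]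
  have : (0 : ℝ) ≤ ((p : ℝ) ^ N)⁻¹ := by positivity
  exact mul_le_of_le_one_left this (Padic.norm_int_le_one _)

theorem finiteFourier_inversion {N : ℕ} {F : ℤ_[p] → ℂ}
    (hF : ∀ x y, ‖x - y‖ ≤ (p : ℝ) ^ (-(N : ℤ)) → F x = F y) (m : ℤ) :
    ∑ t ∈ Finset.range (p ^ N), finiteFourier N F t *
      eP p ((t : ℚ_[p]) * (m : ℚ_[p]) / (p : ℚ_[p]) ^ N) = (p : ℂ) ^ N * F m := by
  unfold finiteFourier
  simp_rw [Finset.sum_mul]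
  rw [Finset.sum_comm]
  have e : ∀ a ∈ Finset.range (p ^ N), ∑ t ∈ Finset.range (p ^ N),
      F a * eP p (-(((t : ℤ) : ℚ_[p]) * (a : ℚ_[p])) / (p : ℚ_[p]) ^ N) *
        eP p ((t : ℚ_[p]) * (m : ℚ_[p]) / (p : ℚ_[p]) ^ N) =
      if a = (m : ℤ_[p]).appr N then (p : ℂ) ^ N * F m else 0 := by
    intro a ha
    have e1 : ∀ t : ℕ, F a * eP p (-(((t : ℤ) : ℚ_[p]) * (a : ℚ_[p])) / (p : ℚ_[p]) ^ N) *
        eP p ((t : ℚ_[p]) * (m : ℚ_[p]) / (p : ℚ_[p]) ^ N) =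
        F a * eP p ((t : ℚ_[p]) * (((m : ℤ_[p]) - a : ℤ_[p]) : ℚ_[p]) / (p : ℚ_[p]) ^ N) := by
      intro t
      rw [mul_assoc, ← eP_add]
      push_cast
      ring_nf
    simp_rw [e1]
    rw [← Finset.mul_sum, sum_eP_mul_div]
    by_cases h : a = (m : ℤ_[p]).appr N
    · have h' : ‖(m : ℤ_[p]) - a‖ ≤ (p : ℝ) ^ (-(N : ℤ)) := h ▸ norm_sub_appr_le _ _
      rw [if_pos h', if_pos h, ← hF _ _ h', mul_comm]
    · rw [if_neg h, if_neg, mul_zero]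
      exact fun h' => h (appr_eq_of_norm_sub_le (Finset.mem_range.1 ha) h').symm
  rw [Finset.sum_congr rfl e, Finset.sum_ite_eq',
    if_pos (Finset.mem_range.2 (PadicInt.appr_lt _ _))]

theorem finiteFourier_parseval {N : ℕ} {F : ℤ_[p] → ℂ}
    (hF : ∀ x y, ‖x - y‖ ≤ (p : ℝ) ^ (-(N : ℤ)) → F x = F y) :
    ∑ t ∈ Finset.range (p ^ N), finiteFourier N F t * (starRingEnd ℂ) (finiteFourier N F t) =
      (p : ℂ) ^ N * ∑ a ∈ Finset.range (p ^ N), F a * (starRingEnd ℂ) (F a) := by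
  have e : ∀ t : ℕ, finiteFourier N F t * (starRingEnd ℂ) (finiteFourier N F t) =
      ∑ a ∈ Finset.range (p ^ N), (starRingEnd ℂ) (F a) * (finiteFourier N F t *
        eP p ((t : ℚ_[p]) * ((a : ℤ) : ℚ_[p]) / (p : ℚ_[p]) ^ N)) := by
    intro t
    conv_lhs => rw [finiteFourier.eq_1 N F t, map_sum, ← finiteFourier, Finset.mul_sum]
    refine Finset.sum_congr rfl fun a _ => ?_
    rw [map_mul, conj_eP]
    push_cast
    ring_nf
  simp_rw [e]
  rw [Finset.sum_comm, Finset.mul_sum]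
  refine Finset.sum_congr rfl fun a _ => ?_
  rw [← Finset.mul_sum, finiteFourier_inversion hF]
  push_cast
  ring

/-- Stationary phase for a phase `H` on `ℤ_p` with derivative `G`. Suppose that, modulo `p^N`, the
deviation of `H` from its tangent line at `m` is the function `H` itself on the ball of radius
`p^{-q}`, whatever `m` is, and that `φ t` is a stationary point of `H(x) - tx` with
`‖G a - t‖ = ‖a - φ t‖`. Then the finite Fourier transform of `e(H/p^N)` is a constant times the
exponential of the Legendre transform of `H`. -/
theorem finiteFourier_stationaryPhase {N q : ℕ} (hq : 2 * q ≤ N) {H : ℤ_[p] → ℚ_[p]}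
    {G : ℤ_[p] → ℤ_[p]} {φ : ℤ → ℤ_[p]}
    (hA : ∀ m δ : ℤ_[p], ‖δ‖ ≤ (p : ℝ) ^ (-(q : ℤ)) →
      ‖H (m + δ) - H m - (δ : ℚ_[p]) * G m - H δ‖ ≤ (p : ℝ) ^ (-(N : ℤ)))
    (hB : ∀ δ : ℤ_[p], ‖δ‖ ≤ (p : ℝ) ^ (-((N - q : ℕ) : ℤ)) → ‖H δ‖ ≤ (p : ℝ) ^ (-(N : ℤ)))
    (hG : ∀ (a : ℤ_[p]) (t : ℤ), ‖G a - t‖ = ‖a - φ t‖) :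
    (∀ x y, ‖x - y‖ ≤ (p : ℝ) ^ (-(N : ℤ)) →
      eP p (H x / (p : ℚ_[p]) ^ N) = eP p (H y / (p : ℚ_[p]) ^ N)) ∧
    ∃ K : ℂ, ‖K‖ ^ 2 = (p : ℝ) ^ N ∧ ∀ t : ℤ,
      finiteFourier N (fun x => eP p (H x / (p : ℚ_[p]) ^ N)) t =
        K * eP p ((H (φ t) - (t : ℚ_[p]) * φ t) / (p : ℚ_[p]) ^ N) := by
  have hp0 : (0 : ℝ) < p := by exact_mod_cast (Fact.out : p.Prime).pos
  have hp1 : (1 : ℝ) ≤ p := by exact_mod_cast (Fact.out : p.Prime).one_lt.le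
  have hpQ : (p : ℚ_[p]) ≠ 0 := by exact_mod_cast (Fact.out : p.Prime).ne_zero
  have mono : ∀ {i j : ℕ}, i ≤ j → (p : ℝ) ^ (-(j : ℤ)) ≤ (p : ℝ) ^ (-(i : ℤ)) := by
    intro i j hij
    exact zpow_le_zpow_right₀ hp1 (by omega)
  -- combining both hypotheses: first-order expansion on the smaller balls
  have hAB : ∀ m δ : ℤ_[p], ‖δ‖ ≤ (p : ℝ) ^ (-((N - q : ℕ) : ℤ)) →
      ‖H (m + δ) - H m - (δ : ℚ_[p]) * G m‖ ≤ (p : ℝ) ^ (-(N : ℤ)) := by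
    intro m δ hδ
    have h1 := hA m δ (hδ.trans (mono (by omega)))
    have h2 := hB δ hδ
    have : H (m + δ) - H m - (δ : ℚ_[p]) * G m
      = (H (m + δ) - H m - (δ : ℚ_[p]) * G m - H δ) + H δ := by ring
    rw [this]
    exact (Padic.nonarchimedean _ _).trans (max_le h1 h2)
  set F : ℤ_[p] → ℂ := fun x => eP p (H x / (p : ℚ_[p]) ^ N) with hFdef
  have hF : ∀ x y, ‖x - y‖ ≤ (p : ℝ) ^ (-(N : ℤ)) → F x = F y := by
    intro x y hxy
    apply eP_div_congr
    have h1 := hAB y (x - y) (hxy.trans (mono (by omega)))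
    rw [add_sub_cancel] at h1
    have : H x - H y = (H x - H y - ((x - y : ℤ_[p]) : ℚ_[p]) * G y)
      + (((x - y) * G y : ℤ_[p]) : ℚ_[p]) := by push_cast; ring
    rw [this]
    refine (Padic.nonarchimedean _ _).trans (max_le h1 ?_)
    rw [PadicInt.padic_norm_e_of_padicInt, norm_mul]
    exact (mul_le_of_le_one_right (norm_nonneg _) (PadicInt.norm_le_one _)).trans hxy
  refine ⟨hF, ?_⟩
  set K : ℂ := ∑ a ∈ Finset.range (p ^ N),
    if ‖(a : ℤ_[p])‖ ≤ (p : ℝ) ^ (-(q : ℤ)) then F a else 0 with hK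
  have key : ∀ t : ℤ, finiteFourier N F t =
      K * eP p ((H (φ t) - (t : ℚ_[p]) * φ t) / (p : ℚ_[p]) ^ N) := by
    intro t
    set Θ : ℤ_[p] → ℂ := fun x => F x * eP p (-((t : ℚ_[p]) * x) / (p : ℚ_[p]) ^ N) with hΘ
    have hΘp : ∀ x y, ‖x - y‖ ≤ (p : ℝ) ^ (-(N : ℤ)) → Θ x = Θ y := by
      intro x y hxy
      simp only [hΘ]
      rw [hF x y hxy]
      congr 1
      apply eP_div_congr
      have : -((t : ℚ_[p]) * x) - -((t : ℚ_[p]) * y)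
        = (((-t : ℤ) * (x - y) : ℤ_[p]) : ℚ_[p]) := by push_cast; ring
      rw [this, PadicInt.padic_norm_e_of_padicInt, norm_mul]
      exact (mul_le_of_le_one_left (norm_nonneg _) (PadicInt.norm_le_one _)).trans hxy
    have h0 : finiteFourier N F t = ∑ a ∈ Finset.range (p ^ N), Θ a := by
      unfold finiteFourier
      simp [hΘ]
    -- average over translations by `p^{N-q} b`
    have hshift : ∀ (a : ℤ_[p]) (b : ℕ), Θ (a + (p : ℤ_[p]) ^ (N - q) * b) =
        Θ a * eP p ((b : ℚ_[p]) * ((G a - t : ℤ_[p]) : ℚ_[p]) / (p : ℚ_[p]) ^ q) := by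
      intro a b
      simp only [hΘ, hFdef]
      rw [mul_assoc, ← eP_add, ← eP_add, ← eP_add]
      have hδ : ‖(p : ℤ_[p]) ^ (N - q) * b‖ ≤ (p : ℝ) ^ (-((N - q : ℕ) : ℤ)) := by
        rw [norm_mul, norm_pow, PadicInt.norm_p, inv_pow, zpow_neg, zpow_natCast]
        exact mul_le_of_le_one_right (by positivity) (PadicInt.norm_le_one _)
      have h1 := hAB a _ hδ
      apply eP_congr
      rw [← norm_div_pow_le_one_iff] at h1
      convert h1 using 2
      have hs : (p : ℚ_[p]) ^ N = (p : ℚ_[p]) ^ (N - q) * (p : ℚ_[p]) ^ q := by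
        rw [← pow_add]; congr 1; omega
      rw [hs]
      push_cast
      field_simp
      ring
    have h1 : (p : ℂ) ^ q * ∑ a ∈ Finset.range (p ^ N), Θ a =
        (p : ℂ) ^ q * ∑ a ∈ Finset.range (p ^ N),
          if ‖(a : ℤ_[p]) - φ t‖ ≤ (p : ℝ) ^ (-(q : ℤ)) then Θ a else 0 := by
      calc (p : ℂ) ^ q * ∑ a ∈ Finset.range (p ^ N), Θ a
          = ∑ b ∈ Finset.range (p ^ q), ∑ a ∈ Finset.range (p ^ N),
              Θ (a + (p : ℤ_[p]) ^ (N - q) * b) := by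
            rw [Finset.sum_congr rfl fun b _ => sum_range_add_eq hΘp _]
            simp
        _ = ∑ a ∈ Finset.range (p ^ N), Θ a * ∑ b ∈ Finset.range (p ^ q),
              eP p ((b : ℚ_[p]) * ((G a - t : ℤ_[p]) : ℚ_[p]) / (p : ℚ_[p]) ^ q) := by
            rw [Finset.sum_comm]
            refine Finset.sum_congr rfl fun a _ => ?_
            rw [Finset.mul_sum]
            exact Finset.sum_congr rfl fun b _ => hshift _ _
        _ = _ := by
            rw [Finset.mul_sum]
            refine Finset.sum_congr rfl fun a _ => ?_
            rw [sum_eP_mul_div, hG]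
            split_ifs <;> ring
    have hpq : (p : ℂ) ^ q ≠ 0 := pow_ne_zero _ (by exact_mod_cast (Fact.out : p.Prime).ne_zero)
    rw [h0, mul_left_cancel₀ hpq h1]
    -- recentre at the stationary point
    have h2 := sum_range_add_eq (N := N) (F := fun x => if ‖x - φ t‖ ≤ (p : ℝ) ^ (-(q : ℤ))
      then Θ x else 0) ?_ (φ t)
    · rw [← h2, hK, Finset.sum_mul]
      refine Finset.sum_congr rfl fun a _ => ?_
      rw [add_sub_cancel_right]
      split_ifs with ha
      · simp only [hΘ, hFdef]
        rw [← eP_add, ← eP_add]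
        apply eP_congr
        have h3 := hA (φ t) a ha
        have h4 : ‖((a : ℤ_[p]) : ℚ_[p]) * ((G (φ t) - t : ℤ_[p]) : ℚ_[p])‖
            ≤ (p : ℝ) ^ (-(N : ℤ)) := by
          have : G (φ t) - t = 0 := by
            rw [← norm_eq_zero, hG, sub_self, norm_zero]
          rw [this]
          simp only [PadicInt.coe_zero, mul_zero, norm_zero]
          positivity
        have h5 := (Padic.nonarchimedean _ _).trans (max_le h3 h4)
        rw [← norm_div_pow_le_one_iff] at h5
        convert h5 using 2
        rw [add_comm (a : ℤ_[p])]
        push_cast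
        ring
      · simp
    · intro x y hxy
      have : ‖x - φ t‖ ≤ (p : ℝ) ^ (-(q : ℤ)) ↔ ‖y - φ t‖ ≤ (p : ℝ) ^ (-(q : ℤ)) := by
        have hxy' := hxy.trans (mono (show q ≤ N by omega))
        constructor
        · intro h
          have e : y - φ t = -(x - y) + (x - φ t) := by ring
          rw [e]
          exact (PadicInt.nonarchimedean _ _).trans (max_le (by rwa [norm_neg]) h)
        · intro h
          have e : x - φ t = (x - y) + (y - φ t) := by ring
          rw [e]
          exact (PadicInt.nonarchimedean _ _).trans (max_le hxy' h)
      simp only [this, hΘp x y hxy]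
  refine ⟨K, ?_, key⟩
  -- both `e(H/p^N)` and the exponential in `key` have absolute value one: compare in Parseval
  have hpars := finiteFourier_parseval hF
  have conj1 : ∀ x : ℚ_[p], eP p x * (starRingEnd ℂ) (eP p x) = 1 := by
    intro x
    rw [Complex.mul_conj, Complex.normSq_eq_norm_sq, norm_eP]
    simp
  have l : ∀ t : ℕ, finiteFourier N F t * (starRingEnd ℂ) (finiteFourier N F t)
      = K * (starRingEnd ℂ) K := by
    intro t
    rw [key, map_mul]
    have := conj1 ((H (φ t) - ((t : ℤ) : ℚ_[p]) * φ t) / (p : ℚ_[p]) ^ N)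
    linear_combination (K * (starRingEnd ℂ) K) * this
  have r : ∀ a : ℕ, F a * (starRingEnd ℂ) (F a) = 1 := fun a => conj1 _
  simp_rw [l, r] at hpars
  simp only [Finset.sum_const, Finset.card_range, nsmul_eq_mul, mul_one, Nat.cast_pow] at hpars
  have hpN : (p : ℂ) ^ N ≠ 0 := pow_ne_zero _ (by exact_mod_cast (Fact.out : p.Prime).ne_zero)
  have h6 := mul_left_cancel₀ hpN hpars
  rw [Complex.mul_conj, Complex.normSq_eq_norm_sq] at h6
  exact_mod_cast h6

end FiniteSums

/-! ### Poisson summation with periodic weights -/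

section Poisson

theorem SchwartzMap.summable_int (f : 𝓢(ℝ, ℂ)) : Summable fun n : ℤ => f n := by
  have h1 := (f.isBigO_cocompact_rpow (-2)).comp_tendsto Int.tendsto_coe_cofinite
  refine summable_of_isBigO ?_ h1
  have := Real.summable_abs_int_rpow (b := 2) one_lt_two
  simpa [Function.comp_def] using this

/-- A Schwartz function is summable over a translated lattice. -/
theorem SchwartzMap.summable_int_affine (f : 𝓢(ℝ, ℂ)) {α : ℝ} (hα : α ≠ 0) (β : ℝ) :
    Summable fun n : ℤ => f (α * n + β) := by
  have hα' : (0 : ℝ) < |α| := abs_pos.2 hα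
  have htemp : (fun x : ℝ => α * x + β).HasTemperateGrowth := by fun_prop
  have hanti : AntilipschitzWith (Real.toNNReal |α|⁻¹) (fun x : ℝ => α * x + β) := by
    refine AntilipschitzWith.of_le_mul_dist fun x y => ?_
    rw [Real.coe_toNNReal _ (by positivity), Real.dist_eq, Real.dist_eq]
    rw [show α * x + β - (α * y + β) = α * (x - y) by ring, abs_mul]
    field_simp
    exact le_rfl
  exact SchwartzMap.summable_int (SchwartzMap.compCLMOfAntilipschitz ℂ htemp hanti f)

/-- Poisson summation for `x ↦ e(θx) h(x/B)`. -/
theorem SchwartzMap.tsum_exp_mul_eq (h : 𝓢(ℝ, ℂ)) {B : ℝ} (hB : 0 < B) (θ : ℝ) :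
    ∑' m : ℤ, Complex.exp (2 * Real.pi * Complex.I * (m * θ : ℝ)) * h (m / B) =
      B * ∑' k : ℤ, 𝓕 (h : ℝ → ℂ) (-(B * k) - B * θ) := by
  let L : ℝ ≃L[ℝ] ℝ := ContinuousLinearEquiv.unitsEquivAut ℝ (Units.mk0 B⁻¹ (inv_ne_zero hB.ne'))
  have hL : ∀ x, L x = x / B := fun x => by
    simp [L, ContinuousLinearEquiv.unitsEquivAut, div_eq_mul_inv]
  let hb : 𝓢(ℝ, ℂ) := SchwartzMap.compCLMOfContinuousLinearEquiv ℂ L h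
  have hhb : ∀ x, hb x = h (x / B) := fun x => by
    simp [hb, hL]
  have hF : ∀ ξ : ℝ, 𝓕 hb ξ = B * 𝓕 (h : ℝ → ℂ) (B * ξ) := by
    intro ξ
    rw [SchwartzMap.fourier_coe, Real.fourier_real_eq_integral_exp_smul,
      Real.fourier_real_eq_integral_exp_smul]
    have := MeasureTheory.Measure.integral_comp_div
      (fun x : ℝ => Complex.exp (((-2 * Real.pi * x * (B * ξ) : ℝ) : ℂ) * Complex.I) • h x) B
    rw [abs_of_pos hB] at this
    simp only [smul_eq_mul] at this
    rw [Complex.real_smul] at this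
    simp only [smul_eq_mul]
    rw [← this]
    refine MeasureTheory.integral_congr_ae (Filter.Eventually.of_forall fun x => ?_)
    simp only [hhb]
    congr 4
    field_simp
  have hP := SchwartzMap.tsum_eq_tsum_fourier (𝓕 hb) (-θ)
  -- applying Poisson summation to `𝓕 hb` puts the exponential on the side of `h`
  have hinv : ∀ x : ℝ, 𝓕 (𝓕 hb) x = hb (-x) := by
    intro x
    have h1 : 𝓕⁻ (𝓕 hb) = hb := by simp
    conv_rhs => rw [← h1]
    rw [SchwartzMap.fourierInv_apply_eq]
    simp
  rw [← tsum_mul_left]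
  calc _ = ∑' m : ℤ, 𝓕 (𝓕 hb) m * fourier m ((-θ : ℝ) : UnitAddCircle) := by
        rw [← (Equiv.neg ℤ).tsum_eq]
        refine tsum_congr fun m => ?_
        rw [hinv, hhb, fourier_coe_apply, mul_comm]
        simp only [Equiv.neg_apply, Int.cast_neg]
        congr 2
        push_cast
        ring
    _ = _ := by
        rw [← hP, ← (Equiv.neg ℤ).tsum_eq]
        refine tsum_congr fun k => ?_
        rw [hF, Equiv.neg_apply, Int.cast_neg,
          show B * (-θ + -(k : ℝ)) = -(B * k) - B * θ by ring]

theorem SchwartzMap.summable_bounded_mul (h : 𝓢(ℝ, ℂ)) {B : ℝ} (hB : 0 < B) {F : ℤ → ℂ}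
    (hF : ∀ m, ‖F m‖ ≤ 1) : Summable fun m : ℤ => F m * h (m / B) := by
  have := SchwartzMap.summable_int_affine h (inv_ne_zero hB.ne') 0
  refine Summable.of_norm_bounded this.norm fun m => ?_
  rw [norm_mul]
  refine (mul_le_of_le_one_left (norm_nonneg _) (hF m)).trans_eq ?_
  simp [div_eq_inv_mul]

theorem SchwartzMap.summable_periodic_mul_fourier (h : 𝓢(ℝ, ℂ)) {B : ℝ} (hB : 0 < B) (θ : ℝ)
    {M : ℕ} (hM : 0 < M) {S : ℤ → ℂ} (hS : ∀ t k : ℤ, S (t + M * k) = S t) :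
    Summable fun t : ℤ => S t * 𝓕 (h : ℝ → ℂ) (-(B * t / M) - B * θ) := by
  have hM' : (M : ℝ) ≠ 0 := by exact_mod_cast hM.ne'
  obtain ⟨C, hC⟩ : ∃ C, ∀ t, ‖S t‖ ≤ C := by
    refine ⟨∑ j ∈ Finset.range M, ‖S j‖, fun t => ?_⟩
    have hMz : (M : ℤ) ≠ 0 := by exact_mod_cast hM.ne'
    have h1 : S t = S (t % M).toNat := by
      rw [Int.toNat_of_nonneg (Int.emod_nonneg _ hMz)]
      conv_lhs => rw [← Int.emod_add_mul_ediv t M, hS]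
    rw [h1]
    refine Finset.single_le_sum (f := fun j : ℕ => ‖S j‖) (fun _ _ => norm_nonneg _)
      (Finset.mem_range.2 ?_)
    have := Int.emod_lt_of_pos t (show (0 : ℤ) < M by exact_mod_cast hM)
    have := Int.emod_nonneg t hMz
    omega
  have hs := SchwartzMap.summable_int_affine (𝓕 h)
    (α := -(B / M)) (by simp [hB.ne', hM']) (-(B * θ))
  refine Summable.of_norm_bounded (hs.norm.mul_left C) fun t => ?_
  rw [norm_mul]
  have : -(B / M) * t + -(B * θ) = -(B * t / M) - B * θ := by ring
  rw [this, SchwartzMap.fourier_coe]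
  exact mul_le_mul_of_nonneg_right (hC t) (norm_nonneg _)

/-- Poisson summation for a Schwartz function weighted by a function `F` on `ℤ/M`, whose finite
Fourier coefficients are `S t / M`. -/
theorem SchwartzMap.tsum_periodic_mul_eq (h : 𝓢(ℝ, ℂ)) {B : ℝ} (hB : 0 < B) (θ : ℝ) {M : ℕ}
    (hM : 0 < M) {F S : ℤ → ℂ} (hS : ∀ t k : ℤ, S (t + M * k) = S t)
    (hFS : ∀ m : ℤ, F m = (M : ℂ)⁻¹ * ∑ t ∈ Finset.range M,
      S t * Complex.exp (2 * Real.pi * Complex.I * (m * (t / M) : ℝ))) :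
    ∑' m : ℤ, F m * (Complex.exp (2 * Real.pi * Complex.I * (m * θ : ℝ)) * h (m / B)) =
      B / M * ∑' t : ℤ, S t * 𝓕 (h : ℝ → ℂ) (-(B * t / M) - B * θ) := by
  have hM' : (M : ℝ) ≠ 0 := by exact_mod_cast hM.ne'
  have hMC : (M : ℂ) ≠ 0 := by exact_mod_cast hM.ne'
  have : NeZero M := ⟨hM.ne'⟩
  have hnorm : ∀ x : ℝ, ‖Complex.exp (2 * Real.pi * Complex.I * x)‖ = 1 := by
    intro x
    rw [show (2 * Real.pi * Complex.I * x : ℂ) = ((2 * Real.pi * x : ℝ) : ℂ) * Complex.I by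
      push_cast; ring]
    exact Complex.norm_exp_ofReal_mul_I _
  have hsum0 : ∀ x : ℝ, Summable fun m : ℤ =>
      Complex.exp (2 * Real.pi * Complex.I * (m * x : ℝ)) * h (m / B) :=
    fun x => SchwartzMap.summable_bounded_mul h hB fun m => (hnorm _).le
  have e1 : ∀ m : ℤ, F m * (Complex.exp (2 * Real.pi * Complex.I * (m * θ : ℝ)) * h (m / B)) =
      ∑ t ∈ Finset.range M, (M : ℂ)⁻¹ * S t *
        (Complex.exp (2 * Real.pi * Complex.I * (m * (t / M + θ) : ℝ)) * h (m / B)) := by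
    intro m
    rw [hFS, Finset.mul_sum, Finset.sum_mul]
    refine Finset.sum_congr rfl fun t _ => ?_
    rw [show (2 * Real.pi * Complex.I * (m * (t / M + θ) : ℝ) : ℂ)
      = 2 * Real.pi * Complex.I * (m * (t / M) : ℝ) + 2 * Real.pi * Complex.I * (m * θ : ℝ) by
        push_cast; ring, Complex.exp_add]
    ring
  simp_rw [e1]
  rw [Summable.tsum_finsetSum fun t _ => (hsum0 _).mul_left _]
  simp_rw [tsum_mul_left, SchwartzMap.tsum_exp_mul_eq h hB]
  -- split the dual sum into residue classes modulo `M`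
  have hg : Summable fun t : ℤ => S t * 𝓕 (h : ℝ → ℂ) (-(B * t / M) - B * θ) :=
    SchwartzMap.summable_periodic_mul_fourier h hB θ hM hS
  have e2 := (Int.divModEquiv M).symm.tsum_eq
    (fun t : ℤ => S t * 𝓕 (h : ℝ → ℂ) (-(B * t / M) - B * θ))
  have hg2 := (Int.divModEquiv M).symm.summable_iff.2 hg
  have hg3 := (Equiv.prodComm ℤ (Fin M)).symm.summable_iff.2 hg2
  rw [← e2, ← (Equiv.prodComm ℤ (Fin M)).symm.tsum_eq]
  simp only [Function.comp_def] at hg3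
  rw [hg3.tsum_prod, tsum_fintype,
    Finset.mul_sum, ← Fin.sum_univ_eq_sum_range (fun t : ℕ => (M : ℂ)⁻¹ * S t *
      (B * ∑' k : ℤ, 𝓕 (h : ℝ → ℂ) (-(B * k) - B * (t / M + θ))))]
  refine Finset.sum_congr rfl fun j _ => ?_
  have : ∀ k : ℤ, S ((Int.divModEquiv M).symm (k, j)) = S j := by
    intro k
    simp only [Int.divModEquiv, Equiv.coe_fn_symm_mk]
    rw [add_comm, mul_comm]
    exact hS _ _
  simp only [Equiv.prodComm_symm, Equiv.prodComm_apply, Prod.swap_prod_mk, this]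
  rw [tsum_mul_left]
  have e3 : ∀ k : ℤ, -(B * (((Int.divModEquiv M).symm (k, j) : ℤ) : ℝ) / M) - B * θ
      = -(B * k) - B * ((j : ℕ) / M + θ) := by
    intro k
    simp only [Int.divModEquiv, Equiv.coe_fn_symm_mk]
    push_cast
    field_simp
    ring
  simp_rw [e3]
  ring

end Poisson

/-! ### Gauss norms and substitution of `p`-adic power series -/

section GaussBound

open PowerSeries

variable {p : ℕ} [Fact p.Prime]

/-- The Gauss norm of `f` on the disc of radius `r` is at most `M`. -/
def GaussBound (r M : ℝ) (f : ℚ_[p]⟦X⟧) : Prop := ∀ k, ‖coeff k f‖ * r ^ k ≤ M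

variable {r M M' : ℝ} {f g : ℚ_[p]⟦X⟧}

theorem GaussBound.add (hr : 0 ≤ r) (hf : GaussBound r M f) (hg : GaussBound r M g) :
    GaussBound r M (f + g) := by
  intro k
  rw [map_add]
  have hk : 0 ≤ r ^ k := pow_nonneg hr k
  calc ‖coeff k f + coeff k g‖ * r ^ k ≤ max ‖coeff k f‖ ‖coeff k g‖ * r ^ k := by
        gcongr; exact Padic.nonarchimedean _ _
    _ ≤ M := by
        rw [max_mul_of_nonneg _ _ hk]
        exact max_le (hf k) (hg k)

theorem GaussBound.neg (hf : GaussBound r M f) : GaussBound r M (-f) := by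
  intro k
  rw [map_neg, norm_neg]
  exact hf k

theorem GaussBound.sub (hr : 0 ≤ r) (hf : GaussBound r M f) (hg : GaussBound r M g) :
    GaussBound r M (f - g) := by
  rw [sub_eq_add_neg]
  exact hf.add hr hg.neg

theorem GaussBound.mono (hf : GaussBound r M f) (h : M ≤ M') : GaussBound r M' f :=
  fun k => (hf k).trans h

theorem GaussBound.nonneg (hf : GaussBound r M f) : 0 ≤ M := by
  have := hf 0
  rw [pow_zero, mul_one] at this
  exact (norm_nonneg _).trans this

theorem GaussBound.mul (hr : 0 ≤ r) (hf : GaussBound r M f) (hg : GaussBound r M' g) :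
    GaussBound r (M * M') (f * g) := by
  intro k
  rw [coeff_mul]
  obtain ⟨⟨i, j⟩, hij, hle⟩ := IsUltrametricDist.exists_norm_finsetSum_le_of_nonempty
    (t := Finset.HasAntidiagonal.antidiagonal k) ⟨(0, k), by simp⟩
    (fun ij => coeff ij.1 f * coeff ij.2 g)
  have hk : 0 ≤ r ^ k := pow_nonneg hr k
  refine (mul_le_mul_of_nonneg_right hle hk).trans ?_
  rw [Finset.HasAntidiagonal.mem_antidiagonal] at hij
  simp only at hij ⊢
  rw [← hij, norm_mul, pow_add, mul_mul_mul_comm]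
  exact mul_le_mul (hf i) (hg j) (by positivity) hf.nonneg

theorem GaussBound.one : GaussBound r 1 (1 : ℚ_[p]⟦X⟧) := by
  intro k
  rw [coeff_one]
  split_ifs with h <;> simp [h]

theorem GaussBound.X (hr : 0 ≤ r) : GaussBound r r (X : ℚ_[p]⟦X⟧) := by
  intro k
  rw [coeff_X]
  split_ifs with h <;> simp [h, hr]

theorem GaussBound.pow (hr : 0 ≤ r) (hf : GaussBound r M f) (n : ℕ) :
    GaussBound r (M ^ n) (f ^ n) := by
  induction n with
  | zero => simpa using GaussBound.one
  | succ n ih => rw [pow_succ, pow_succ]; exact ih.mul hr hf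

theorem GaussBound.C_mul (c : ℚ_[p]) (hf : GaussBound r M f) :
    GaussBound r (‖c‖ * M) (C c * f) := by
  intro k
  rw [coeff_C_mul, norm_mul, mul_assoc]
  exact mul_le_mul_of_nonneg_left (hf k) (norm_nonneg _)

theorem hasSubst_of_constantCoeff {φ : ℚ_[p]⟦X⟧} (h : constantCoeff φ = 0) : HasSubst φ :=
  HasSubst.of_constantCoeff_zero' h

theorem norm_finsum_mul_le {u : ℕ → ℚ_[p]} {c : ℝ} (hc : 0 ≤ c) (hM : 0 ≤ M)
    (h : ∀ d, ‖u d‖ * c ≤ M) : ‖∑ᶠ d, u d‖ * c ≤ M := by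
  refine finsum_induction (fun x : ℚ_[p] => ‖x‖ * c ≤ M) (by simpa using hM) ?_ h
  intro x y hx hy
  refine (mul_le_mul_of_nonneg_right (Padic.nonarchimedean x y) hc).trans ?_
  rw [max_mul_of_nonneg _ _ hc]
  exact max_le hx hy

theorem GaussBound.subst (hr : 0 ≤ r) (hf : GaussBound M M' f) {φ : ℚ_[p]⟦X⟧}
    (h0 : constantCoeff φ = 0) (hφ : GaussBound r M φ) : GaussBound r M' (f.subst φ) := by
  intro k
  rw [coeff_subst' (hasSubst_of_constantCoeff h0)]
  refine norm_finsum_mul_le (pow_nonneg hr k) hf.nonneg fun d => ?_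
  rw [smul_eq_mul, norm_mul, mul_assoc]
  exact (mul_le_mul_of_nonneg_left (hφ.pow hr d k) (norm_nonneg _)).trans (hf d)

theorem GaussBound.pow_sub_pow (hr : 0 ≤ r) {φ ψ : ℚ_[p]⟦X⟧} (hφ : GaussBound r r φ)
    (hψ : GaussBound r r ψ) (h : GaussBound r M (φ - ψ)) (n : ℕ) :
    GaussBound r (M * r ^ n) (φ ^ (n + 1) - ψ ^ (n + 1)) := by
  induction n with
  | zero => simpa using h
  | succ n ih =>
    have e : φ ^ (n + 1 + 1) - ψ ^ (n + 1 + 1)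
      = φ ^ (n + 1) * (φ - ψ) + (φ ^ (n + 1) - ψ ^ (n + 1)) * ψ := by ring
    rw [e]
    refine GaussBound.add hr ?_ ?_
    · exact ((hφ.pow hr (n + 1)).mul hr h).mono (by rw [mul_comm])
    · exact (ih.mul hr hψ).mono (by rw [pow_succ, mul_assoc])

/-- Substitution into a series bounded on the disc of radius `r` does not expand distances. -/
theorem GaussBound.subst_sub_subst (hr : 0 < r) (hf : GaussBound r r f) {φ ψ : ℚ_[p]⟦X⟧}
    (hφ0 : constantCoeff φ = 0) (hψ0 : constantCoeff ψ = 0)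
    (hφ : GaussBound r r φ) (hψ : GaussBound r r ψ) (h : GaussBound r M (φ - ψ)) :
    GaussBound r M (f.subst φ - f.subst ψ) := by
  intro k
  rw [map_sub, coeff_subst' (hasSubst_of_constantCoeff hφ0),
    coeff_subst' (hasSubst_of_constantCoeff hψ0), ← finsum_sub_distrib
    (coeff_subst_finite' (hasSubst_of_constantCoeff hφ0) f k)
    (coeff_subst_finite' (hasSubst_of_constantCoeff hψ0) f k)]
  refine norm_finsum_mul_le (pow_nonneg hr.le k) h.nonneg fun d => ?_
  rw [← smul_sub, ← map_sub]
  cases d with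
  | zero => simpa using h.nonneg
  | succ d =>
    rw [smul_eq_mul, norm_mul, mul_assoc]
    have h1 := GaussBound.pow_sub_pow hr.le hφ hψ h d k
    have h2 : ‖coeff (d + 1) f‖ * r ^ d ≤ 1 := by
      have := hf (d + 1)
      rw [pow_succ, ← mul_assoc] at this
      exact (mul_le_iff_le_one_left hr).1 this
    calc _ ≤ ‖coeff (d + 1) f‖ * (M * r ^ d) := mul_le_mul_of_nonneg_left h1 (norm_nonneg _)
      _ = (‖coeff (d + 1) f‖ * r ^ d) * M := by ring
      _ ≤ 1 * M := mul_le_mul_of_nonneg_right h2 h.nonneg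
      _ = M := one_mul M

/-- The compositional inverse of a series that preserves the disc of radius `r`, with linear
coefficient a unit, preserves the same disc. -/
theorem GaussBound.of_subst_eq_X (hr : 0 ≤ r) {G φ : ℚ_[p]⟦X⟧} (hG0 : constantCoeff G = 0)
    (hG1 : ‖coeff 1 G‖ = 1) (hG : GaussBound r r G) (h : φ.subst G = PowerSeries.X) :
    GaussBound r r φ := by
  intro j
  induction j using Nat.strong_induction_on with
  | _ j ih =>
    -- compare coefficients of `X^j` in `φ(G) = X`: with `G = XU`, only `d ≤ j` contribute, and the
    -- term `d = j` is a unit times the coefficient in question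
    obtain ⟨U, hU⟩ := X_dvd_iff.2 hG0
    have hU0 : coeff 0 U = coeff 1 G := by
      rw [hU, show (1 : ℕ) = 0 + 1 from rfl, coeff_succ_X_mul]
    have hpow : ∀ d, coeff j (G ^ d) = if d ≤ j then coeff (j - d) (U ^ d) else 0 := by
      intro d
      rw [hU, mul_pow, coeff_X_pow_mul']
    have h1 := congrArg (coeff j) h
    rw [coeff_subst' (hasSubst_of_constantCoeff hG0),
      finsum_eq_sum_of_support_subset (s := Finset.range (j + 1)) _ ?_,
      Finset.sum_range_succ] at h1
    · have h2 : coeff j (G ^ j) = coeff 1 G ^ j := by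
        rw [hpow, if_pos le_rfl, Nat.sub_self, coeff_zero_eq_constantCoeff_apply, map_pow,
          ← coeff_zero_eq_constantCoeff_apply, hU0]
      have h3 : coeff j φ * coeff 1 G ^ j = coeff j (PowerSeries.X : ℚ_[p]⟦X⟧)
          + -∑ d ∈ Finset.range j, coeff d φ • coeff j (G ^ d) := by
        rw [← h1, h2, smul_eq_mul]; ring
      have h4 : ‖coeff j φ‖ = ‖coeff j φ * coeff 1 G ^ j‖ := by
        rw [norm_mul, norm_pow, hG1, one_pow, mul_one]
      rw [h4, h3]
      refine (mul_le_mul_of_nonneg_right (Padic.nonarchimedean _ _) (pow_nonneg hr j)).trans ?_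
      rw [max_mul_of_nonneg _ _ (pow_nonneg hr j)]
      refine max_le (GaussBound.X hr j) ?_
      rw [norm_neg]
      rcases Nat.eq_zero_or_pos j with rfl | hj
      · simpa using hr
      · obtain ⟨d, hd, hle⟩ := IsUltrametricDist.exists_norm_finsetSum_le_of_nonempty
          (t := Finset.range j) ⟨0, by simpa using hj⟩ (fun d => coeff d φ • coeff j (G ^ d))
        refine (mul_le_mul_of_nonneg_right hle (pow_nonneg hr j)).trans ?_
        rw [smul_eq_mul, norm_mul, mul_assoc]
        exact (mul_le_mul_of_nonneg_left (hG.pow hr d j) (norm_nonneg _)).trans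
          (ih d (Finset.mem_range.1 hd))
    · intro d hd
      simp only [Finset.coe_range, Set.mem_Iio]
      by_contra hlt
      apply hd
      simp only [hpow]
      rw [if_neg (by omega), smul_zero]

/-- If `P` and `Q` are mutually inverse and `E` is small on the disc of radius `r`, then the
inverse of `P + E` is close to `Q`. -/
theorem GaussBound.inverse_sub_inverse (hr : 0 < r) (hMr : M ≤ r) {P E Q φ : ℚ_[p]⟦X⟧}
    (hP0 : constantCoeff P = 0) (hE0 : constantCoeff E = 0) (hφ0 : constantCoeff φ = 0)
    (hφ : GaussBound r r φ) (hQ : GaussBound r r Q) (hE : GaussBound r M E)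
    (hQP : Q.subst P = PowerSeries.X) (hφG : (P + E).subst φ = PowerSeries.X) :
    GaussBound r M (φ - Q) := by
  have sφ := hasSubst_of_constantCoeff hφ0
  have sP := hasSubst_of_constantCoeff hP0
  -- `φ = Q(P(φ)) = Q(X - E(φ))`
  have h1 : P.subst φ = PowerSeries.X - E.subst φ := by
    rw [← hφG, subst_add sφ]; ring
  have h2 : Q.subst (P.subst φ) = φ := by
    rw [← subst_comp_subst_apply sP sφ, hQP, subst_X sφ]
  have h3 : Q.subst (PowerSeries.X : ℚ_[p]⟦X⟧) = Q := by
    exact (map_algebraMap_eq_subst_X (R := ℚ_[p]) Q).symm.trans (by simp)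
  have hEφ : GaussBound r M (E.subst φ) := GaussBound.subst hr.le hE hφ0 hφ
  have hEφ0 : constantCoeff (E.subst φ) = 0 := constantCoeff_subst_eq_zero hφ0 E hE0
  have hd : GaussBound r M (Q.subst (PowerSeries.X - E.subst φ) - Q.subst PowerSeries.X) := by
    refine GaussBound.subst_sub_subst hr hQ (by simp [hEφ0]) (by simp)
      (GaussBound.sub hr.le (GaussBound.X hr.le) (hEφ.mono hMr)) (GaussBound.X hr.le) ?_
    rw [sub_sub_cancel_left]
    exact hEφ.neg
  rwa [← h1, h2, h3] at hd

end GaussBound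

/-! ### Evaluation of `p`-adic power series on `ℤ_p` -/

section Evaluation

open PowerSeries Filter

variable {p : ℕ} [Fact p.Prime]

/-- The coefficients of `f` tend to zero, so that `f` converges on `ℤ_p`. -/
def Restricted (f : ℚ_[p]⟦X⟧) : Prop := Tendsto (fun k => coeff k f) atTop (nhds 0)

variable {f g : ℚ_[p]⟦X⟧} {x : ℚ_[p]}

theorem Restricted.iff_isRestricted : Restricted f ↔ IsRestricted 1 f := by
  rw [isRestricted_iff', Restricted, tendsto_zero_iff_norm_tendsto_zero]
  simp

theorem Restricted.mul (hf : Restricted f) (hg : Restricted g) : Restricted (f * g) := by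
  rw [Restricted.iff_isRestricted] at *
  exact isRestricted.mul 1 hf hg

theorem Restricted.add (hf : Restricted f) (hg : Restricted g) : Restricted (f + g) := by
  simpa [Restricted] using Tendsto.add hf hg

theorem Restricted.C (c : ℚ_[p]) : Restricted (C c) := by
  rw [Restricted.iff_isRestricted]; exact isRestricted_C 1 c

theorem Restricted.X : Restricted (X : ℚ_[p]⟦X⟧) := by
  rw [Restricted.iff_isRestricted]
  simpa [X_eq] using isRestricted_monomial 1 1 (1 : ℚ_[p])

theorem Restricted.pow (hf : Restricted f) (n : ℕ) : Restricted (f ^ n) := by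
  induction n with
  | zero => simpa using Restricted.C (1 : ℚ_[p])
  | succ n ih => rw [pow_succ]; exact ih.mul hf

theorem GaussBound.restricted {r M : ℝ} (hr : 1 < r) (hf : GaussBound r M f) : Restricted f := by
  have h0 : Tendsto (fun k : ℕ => M * r⁻¹ ^ k) atTop (nhds 0) := by
    simpa using (tendsto_pow_atTop_nhds_zero_of_lt_one (by positivity)
      (inv_lt_one_of_one_lt₀ hr)).const_mul M
  refine squeeze_zero_norm (fun k => ?_) h0
  rw [inv_pow, ← div_eq_mul_inv, le_div_iff₀ (by positivity)]
  exact hf k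

theorem Restricted.summable (hf : Restricted f) (hx : ‖x‖ ≤ 1) :
    Summable fun k => coeff k f * x ^ k := by
  apply NonarchimedeanAddGroup.summable_of_tendsto_cofinite_zero
  rw [Nat.cofinite_eq_atTop]
  refine squeeze_zero_norm (fun k => ?_) (tendsto_zero_iff_norm_tendsto_zero.1 hf)
  rw [norm_mul, norm_pow]
  exact mul_le_of_le_one_right (norm_nonneg _) (pow_le_one₀ (norm_nonneg _) hx)

theorem Restricted.evalAt_add (hf : Restricted f) (hg : Restricted g) (hx : ‖x‖ ≤ 1) :
    evalAt p (f + g) x = evalAt p f x + evalAt p g x := by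
  unfold evalAt
  rw [← (hf.summable hx).tsum_add (hg.summable hx)]
  simp [add_mul]

theorem evalAt_C (c x : ℚ_[p]) : evalAt p (C c) x = c := by
  unfold evalAt
  rw [tsum_eq_single 0]
  · simp
  · intro k hk; simp [coeff_C, hk]

theorem evalAt_X (x : ℚ_[p]) : evalAt p X x = x := by
  unfold evalAt
  rw [tsum_eq_single 1]
  · simp
  · intro k hk; simp [coeff_X, hk]

theorem evalAt_C_mul (c : ℚ_[p]) (f : ℚ_[p]⟦X⟧) (x : ℚ_[p]) :
    evalAt p (C c * f) x = c * evalAt p f x := by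
  unfold evalAt
  simp_rw [coeff_C_mul, mul_assoc]
  exact tsum_mul_left

theorem nonarchimedeanRing_padic : NonarchimedeanRing ℚ_[p] where
  is_nonarchimedean := NonarchimedeanAddGroup.is_nonarchimedean

theorem tsum_mul_tsum_eq_padic {a b : ℕ → ℚ_[p]} (ha : Summable a) (hb : Summable b) :
    (∑' i, a i) * (∑' i, b i) =
      ∑' k, ∑ ij ∈ Finset.HasAntidiagonal.antidiagonal k, a ij.1 * b ij.2 :=
  have := nonarchimedeanRing_padic (p := p)
  have h : Summable fun ij : ℕ × ℕ => a ij.1 * b ij.2 := ha.mul_of_nonarchimedean hb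
  ha.tsum_mul_tsum_eq_tsum_sum_antidiagonal hb h

theorem Restricted.evalAt_mul (hf : Restricted f) (hg : Restricted g) (hx : ‖x‖ ≤ 1) :
    evalAt p (f * g) x = evalAt p f x * evalAt p g x := by
  unfold evalAt
  rw [tsum_mul_tsum_eq_padic (hf.summable hx) (hg.summable hx)]
  congr 1
  funext k
  rw [coeff_mul, Finset.sum_mul]
  refine Finset.sum_congr rfl fun ij hij => ?_
  have hk : x ^ k = x ^ ij.1 * x ^ ij.2 := by
    rw [← pow_add, Finset.HasAntidiagonal.mem_antidiagonal.1 hij]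
  rw [hk, mul_mul_mul_comm]

theorem Restricted.evalAt_pow (hf : Restricted f) (hx : ‖x‖ ≤ 1) (n : ℕ) :
    evalAt p (f ^ n) x = evalAt p f x ^ n := by
  induction n with
  | zero => simpa using evalAt_C (1 : ℚ_[p]) x
  | succ n ih => rw [pow_succ, pow_succ, (hf.pow n).evalAt_mul hf hx, ih]

theorem norm_evalAt_le {M : ℝ} (hM : 0 ≤ M) (h : ∀ k, ‖coeff k f * x ^ k‖ ≤ M) :
    ‖evalAt p f x‖ ≤ M :=
  IsUltrametricDist.norm_tsum_le_of_forall_le_of_nonneg hM h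

theorem norm_evalAt_le_one (hf : GaussBound 1 1 f) (hx : ‖x‖ ≤ 1) : ‖evalAt p f x‖ ≤ 1 := by
  refine norm_evalAt_le zero_le_one fun k => ?_
  rw [norm_mul, norm_pow]
  have := hf k
  rw [one_pow, mul_one] at this
  exact mul_le_one₀ this (by positivity) (pow_le_one₀ (norm_nonneg _) hx)

/-- Evaluation is compatible with composition of power series. -/
theorem Restricted.evalAt_subst (hf : Restricted f) {φ : ℚ_[p]⟦X⟧} (hφ : Restricted φ)
    (hφ1 : GaussBound 1 1 φ) (hφ0 : constantCoeff φ = 0) (hx : ‖x‖ ≤ 1) :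
    evalAt p (f.subst φ) x = evalAt p f (evalAt p φ x) := by
  have hpow1 : ∀ k j, ‖coeff j (φ ^ k) * x ^ j‖ ≤ 1 := by
    intro k j
    have := hφ1.pow zero_le_one k j
    rw [one_pow, mul_one, one_pow] at this
    rw [norm_mul, norm_pow]
    exact mul_le_one₀ this (by positivity) (pow_le_one₀ (norm_nonneg _) hx)
  have hsum : Summable fun kj : ℕ × ℕ => coeff kj.1 f * (coeff kj.2 (φ ^ kj.1) * x ^ kj.2) := by
    apply NonarchimedeanAddGroup.summable_of_tendsto_cofinite_zero
    rw [tendsto_zero_iff_norm_tendsto_zero, Metric.tendsto_nhds]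
    intro ε hε
    rw [Filter.eventually_cofinite]
    have h1 : {k | ¬ ‖coeff k f‖ < ε}.Finite := by
      have := (tendsto_zero_iff_norm_tendsto_zero.1 hf).eventually_lt_const hε
      rw [← Nat.cofinite_eq_atTop] at this
      exact Filter.eventually_cofinite.1 this
    have h2 : ∀ k, {j | ¬ ‖coeff k f * (coeff j (φ ^ k) * x ^ j)‖ < ε}.Finite := by
      intro k
      have := (((hφ.pow k).summable hx).mul_left (coeff k f)).tendsto_cofinite_zero
      have := (tendsto_zero_iff_norm_tendsto_zero.1 this).eventually_lt_const hε
      exact Filter.eventually_cofinite.1 this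
    refine (h1.biUnion fun k _ => (h2 k).image (Prod.mk k)).subset ?_
    rintro ⟨k, j⟩ hkj
    simp only [Set.mem_ofPred_eq, dist_zero_right, norm_norm] at hkj
    simp only [Set.mem_iUnion, Set.mem_image, Set.mem_ofPred_eq, exists_prop]
    refine ⟨k, fun h => hkj ?_, j, hkj, rfl⟩
    rw [norm_mul]
    exact (mul_le_of_le_one_right (norm_nonneg _) (hpow1 k j)).trans_lt h
  calc evalAt p (f.subst φ) x
      = ∑' j, ∑' k, coeff k f * (coeff j (φ ^ k) * x ^ j) := by
        unfold evalAt
        refine tsum_congr fun j => ?_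
        have hs := hasSubst_of_constantCoeff hφ0
        rw [coeff_subst' hs, ← tsum_eq_finsum (L := .unconditional ℕ) (coeff_subst_finite' hs f j),
          ← tsum_mul_right]
        refine tsum_congr fun k => ?_
        rw [smul_eq_mul, mul_assoc]
    _ = ∑' k, ∑' j, coeff k f * (coeff j (φ ^ k) * x ^ j) :=
        Summable.tsum_comm (f := fun k j => coeff k f * (coeff j (φ ^ k) * x ^ j)) hsum
    _ = evalAt p f (evalAt p φ x) := by
        rw [evalAt.eq_1 p f]
        refine tsum_congr fun k => ?_
        rw [tsum_mul_left, ← hφ.evalAt_pow hx]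
        rfl

/-- The antiderivative of `f` without constant term. -/
noncomputable def antiderivative (f : ℚ_[p]⟦X⟧) : ℚ_[p]⟦X⟧ :=
  .mk fun k => coeff (k - 1) f / k

theorem derivative_antiderivative (f : ℚ_[p]⟦X⟧) :
    derivative ℚ_[p] (antiderivative f) = f := by
  ext k
  have : ((k : ℚ_[p]) + 1) ≠ 0 := by exact_mod_cast Nat.succ_ne_zero k
  rw [coeff_derivative, antiderivative, coeff_mk]
  rw [Nat.add_sub_cancel]
  push_cast
  field_simp

theorem constantCoeff_antiderivative (f : ℚ_[p]⟦X⟧) :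
    constantCoeff (antiderivative f) = 0 := by
  rw [← coeff_zero_eq_constantCoeff_apply]
  simp [antiderivative]

theorem norm_natCast_inv_le {k : ℕ} (hk : k ≠ 0) : ‖(k : ℚ_[p])‖⁻¹ ≤ k := by
  rw [Padic.norm_eq_zpow_neg_valuation (by exact_mod_cast hk), Padic.valuation_natCast, zpow_neg,
    inv_inv, zpow_natCast]
  exact_mod_cast Nat.le_of_dvd (Nat.pos_of_ne_zero hk) pow_padicValNat_dvd

theorem GaussBound.tendsto_antiderivative {r M : ℝ} (hr : 1 < r) (hf : GaussBound r M f) :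
    Restricted (antiderivative f) := by
  have h0 : Tendsto (fun k : ℕ => (M * r) * ((k : ℝ) ^ 1 * r⁻¹ ^ k)) atTop (nhds 0) := by
    simpa using (tendsto_pow_const_mul_const_pow_of_abs_lt_one 1
      (r := r⁻¹) (by rw [abs_of_pos (by positivity)]; exact inv_lt_one_of_one_lt₀ hr)).const_mul
        (M * r)
  refine squeeze_zero_norm (fun k => ?_) h0
  rcases Nat.eq_zero_or_pos k with rfl | hk
  · simp [antiderivative]
  obtain ⟨j, rfl⟩ := Nat.exists_eq_succ_of_ne_zero hk.ne'
  rw [antiderivative, coeff_mk, norm_div, div_eq_mul_inv, Nat.succ_eq_add_one, Nat.add_sub_cancel]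
  have h1 := norm_natCast_inv_le (p := p) hk.ne'
  have h2 : ‖coeff j f‖ ≤ M * r⁻¹ ^ j := by
    rw [inv_pow, ← div_eq_mul_inv, le_div_iff₀ (by positivity)]
    exact hf j
  have hM := hf.nonneg
  calc _ ≤ (M * r⁻¹ ^ j) * (((j + 1 : ℕ) : ℝ)) := by
        gcongr
    _ = _ := by
        have : r ≠ 0 := by positivity
        rw [pow_one, pow_succ]
        field_simp

end Evaluation

/-! ### Binomial series -/

section Binomial

open PowerSeries

variable {p : ℕ} [Fact p.Prime]

theorem factorial_mul_choose (z : ℚ) (k : ℕ) :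
    (k.factorial : ℚ) * Ring.choose z k = ∏ i ∈ Finset.range k, (z - i) := by
  have h := Ring.descPochhammer_eq_factorial_smul_choose z k
  rw [nsmul_eq_mul] at h
  rw [← h, ← descPochhammer_eval_eq_prod_range, ← Polynomial.aeval_eq_smeval, Polynomial.aeval_def,
    ← Polynomial.eval_map, descPochhammer_map]

theorem succ_mul_choose (z : ℚ) (k : ℕ) :
    ((k : ℚ) + 1) * Ring.choose z (k + 1) = (z - k) * Ring.choose z k := by
  have h1 := factorial_mul_choose z k
  have h2 := factorial_mul_choose z (k + 1)
  rw [Finset.prod_range_succ, ← h1, Nat.factorial_succ] at h2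
  have : (k.factorial : ℚ) ≠ 0 := by exact_mod_cast k.factorial_ne_zero
  apply mul_left_cancel₀ this
  push_cast at h2
  linear_combination h2

theorem coeff_onePlusPow (c : ℚ_[p]) (z : ℚ) (k : ℕ) :
    coeff k (onePlusPow p c z) = c ^ k * ((Ring.choose z k : ℚ) : ℚ_[p]) := by
  rw [onePlusPow, coeff_rescale, binomialSeries_coeff, Rat.smul_def, mul_one]

theorem constantCoeff_onePlusPow (c : ℚ_[p]) (z : ℚ) :
    constantCoeff (onePlusPow p c z) = 1 := by
  rw [← coeff_zero_eq_constantCoeff_apply, coeff_onePlusPow]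
  simp

/-- The differential equation `(1 + ct) W' = cz W` of `W = (1 + ct)^z`. -/
theorem derivative_onePlusPow (c : ℚ_[p]) (z : ℚ) :
    (1 + C c * X) * derivative ℚ_[p] (onePlusPow p c z) =
      C (c * (z : ℚ_[p])) * onePlusPow p c z := by
  ext k
  rw [add_mul, one_mul, map_add, mul_assoc, coeff_C_mul, coeff_C_mul, coeff_derivative,
    coeff_onePlusPow, coeff_onePlusPow]
  have h := congrArg (Rat.cast : ℚ → ℚ_[p]) (succ_mul_choose z k)
  push_cast at h
  cases k with
  | zero =>
    rw [coeff_zero_X_mul]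
    simp only [CharP.cast_eq_zero, zero_add, one_mul, sub_zero] at h
    simp only [zero_add, pow_one, pow_zero, one_mul, CharP.cast_eq_zero, mul_one, mul_zero,
      add_zero]
    rw [h]
    ring
  | succ k =>
    rw [coeff_succ_X_mul, coeff_derivative, coeff_onePlusPow]
    push_cast at h ⊢
    linear_combination (c ^ (k + 1 + 1)) * h

/-- Uniqueness for the differential equation `(1 + ct) F' = dF`. -/
theorem eq_of_derivative_eq {c d : ℚ_[p]} {F F' : ℚ_[p]⟦X⟧}
    (hF : (1 + C c * X) * derivative ℚ_[p] F = C d * F)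
    (hF' : (1 + C c * X) * derivative ℚ_[p] F' = C d * F')
    (h0 : constantCoeff F = constantCoeff F') : F = F' := by
  have coeff_succ : ∀ {H : ℚ_[p]⟦X⟧}, (1 + C c * X) * derivative ℚ_[p] H = C d * H → ∀ k : ℕ,
      coeff (k + 1) H * ((k : ℚ_[p]) + 1) = (d - c * k) * coeff k H := by
    intro H hH k
    have h := congrArg (coeff k) hH
    rw [add_mul, one_mul, map_add, mul_assoc, coeff_C_mul, coeff_C_mul, coeff_derivative] at h
    cases k with
    | zero =>
      rw [coeff_zero_X_mul] at h
      simp only [CharP.cast_eq_zero] at h ⊢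
      linear_combination h
    | succ k =>
      rw [coeff_succ_X_mul, coeff_derivative] at h
      push_cast at h ⊢
      linear_combination h
  ext k
  induction k with
  | zero => simpa using h0
  | succ k ih =>
    have hk : ((k : ℚ_[p]) + 1) ≠ 0 := by exact_mod_cast Nat.succ_ne_zero k
    apply mul_right_cancel₀ hk
    rw [coeff_succ hF, coeff_succ hF', ih]

/-- The series `((1 + ct)^z - 1) / d`, for `d ≠ 0`. -/
noncomputable def binomialMap (c d : ℚ_[p]) (z : ℚ) : ℚ_[p]⟦X⟧ :=
  C d⁻¹ * (onePlusPow p c z - 1)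

theorem constantCoeff_binomialMap (c d : ℚ_[p]) (z : ℚ) :
    constantCoeff (binomialMap c d z) = 0 := by
  simp [binomialMap, constantCoeff_onePlusPow]

/-- Inverting `s = ((1 + ct)^z - 1)/d` gives `t = ((1 + ds)^{1/z} - 1)/c`. -/
theorem binomialMap_subst_binomialMap {c d : ℚ_[p]} (hc : c ≠ 0) (hd : d ≠ 0) {z : ℚ}
    (hz : z ≠ 0) : (binomialMap d c z⁻¹).subst (binomialMap c d z) = X := by
  set P := binomialMap c d z with hP
  have sP : HasSubst P := hasSubst_of_constantCoeff (constantCoeff_binomialMap c d z)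
  set A := onePlusPow p c z with hA
  set T := (onePlusPow p d z⁻¹).subst P with hT
  have hzQ : (z : ℚ_[p]) ≠ 0 := by exact_mod_cast hz
  have hCd : (C d * C d⁻¹ : ℚ_[p]⟦X⟧) = 1 := by rw [← map_mul, mul_inv_cancel₀ hd, map_one]
  have hCc : (C c⁻¹ * C c : ℚ_[p]⟦X⟧) = 1 := by rw [← map_mul, inv_mul_cancel₀ hc, map_one]
  have hPA : 1 + C d * P = A := by
    rw [hP, binomialMap, ← mul_assoc, hCd]; ring
  have hone : (1 : ℚ_[p]⟦X⟧).subst P = 1 := by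
    rw [← coe_substAlgHom sP, map_one]
  have hCs : ∀ a : ℚ_[p], (C a : ℚ_[p]⟦X⟧).subst P = C a := fun a => subst_C a
  have hT' : derivative ℚ_[p] T = (derivative ℚ_[p] (onePlusPow p d z⁻¹)).subst P *
      derivative ℚ_[p] P := derivative_subst sP
  have hP' : derivative ℚ_[p] P = C d⁻¹ * derivative ℚ_[p] A := by
    rw [hP, binomialMap, Derivation.leibniz, map_sub, derivative_C, Derivation.map_one_eq_zero]
    simp [hA]
  have h1 := congrArg (PowerSeries.subst P) (derivative_onePlusPow d z⁻¹)
  rw [subst_mul sP, subst_add sP, subst_mul sP, subst_X sP, subst_mul sP, hone, hCs, hCs, hPA,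
    ← hT] at h1
  have h2 := derivative_onePlusPow c z
  rw [← hA] at h2
  have hA0 : A ≠ 0 := by
    intro h
    have := constantCoeff_onePlusPow c z
    rw [← hA, h] at this
    simp at this
  have hconst : (C d⁻¹ * C (d * ((z⁻¹ : ℚ) : ℚ_[p])) * C (c * (z : ℚ_[p])) : ℚ_[p]⟦X⟧) = C c := by
    rw [← map_mul, ← map_mul]
    congr 1
    push_cast
    field_simp
  have h3 : (1 + C c * X) * derivative ℚ_[p] T = C c * T := by
    apply mul_left_cancel₀ hA0
    rw [hT', hP']
    linear_combination (C d⁻¹ * (1 + C c * X) * derivative ℚ_[p] A) * h1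
      + (C d⁻¹ * C (d * ((z⁻¹ : ℚ) : ℚ_[p])) * T) * h2 + (T * A) * hconst
  have h4 : (1 + C c * X) * derivative ℚ_[p] (1 + C c * X : ℚ_[p]⟦X⟧) = C c * (1 + C c * X) := by
    rw [map_add, Derivation.map_one_eq_zero, Derivation.leibniz, derivative_C, derivative_X]
    simp only [smul_eq_mul]
    ring
  have h5 : T = 1 + C c * X := by
    refine eq_of_derivative_eq h3 h4 ?_
    have : T = 1 + (onePlusPow p d z⁻¹ - 1).subst P := by
      rw [subst_sub sP, hone]; ring
    have h0 : constantCoeff ((onePlusPow p d z⁻¹ - 1).subst P : ℚ_[p]⟦X⟧) = 0 :=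
      constantCoeff_subst_eq_zero (constantCoeff_binomialMap c d z) _
        (by simp [constantCoeff_onePlusPow])
    rw [this, map_add, h0]
    simp
  rw [binomialMap, subst_mul sP, subst_sub sP, hone, hCs, ← hT, h5]
  rw [add_sub_cancel_left, ← mul_assoc, hCc, one_mul]

theorem norm_factorial_inv_le {k : ℕ} (hk : k ≠ 0) :
    ‖(k.factorial : ℚ_[p])‖⁻¹ ≤ ((p : ℝ) ^ rho p) ^ (k - 1) := by
  have hp1 : (1 : ℝ) < p := by exact_mod_cast (Fact.out : p.Prime).one_lt
  rw [Padic.norm_eq_zpow_neg_valuation (by exact_mod_cast k.factorial_ne_zero),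
    Padic.valuation_natCast, zpow_neg, inv_inv, zpow_natCast, ← Real.rpow_natCast,
    ← Real.rpow_mul_natCast (by positivity)]
  apply Real.rpow_le_rpow_of_exponent_le hp1.le
  have h := sub_one_mul_padicValNat_factorial_lt_of_ne_zero (p := p) hk
  have h' : (p - 1) * padicValNat p k.factorial ≤ k - 1 := by omega
  have h2 : ((p : ℝ) - 1) * padicValNat p k.factorial ≤ ((k - 1 : ℕ) : ℝ) := by
    have := (Fact.out : p.Prime).one_lt.le
    rw [show (p : ℝ) - 1 = ((p - 1 : ℕ) : ℝ) by push_cast [this]; ring]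
    exact_mod_cast h'
  rw [rho, div_mul_eq_mul_div, one_mul, le_div_iff₀ (by linarith)]
  linarith

theorem norm_ratCast_eq {z : ℚ} (hz : z ≠ 0) :
    ‖(z : ℚ_[p])‖ = (p : ℝ) ^ (-padicValRat p z) := by
  rw [Padic.norm_eq_zpow_neg_valuation (by exact_mod_cast hz), Padic.valuation_ratCast]

/-- The size of binomial coefficients: the denominators `k!` matter only if `z` is not a unit. -/
theorem norm_choose_le {z : ℚ} (hz : z ≠ 0) {k : ℕ} (hk : k ≠ 0) :
    ‖((Ring.choose z k : ℚ) : ℚ_[p])‖ ≤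
      ‖(z : ℚ_[p])‖ * (max 1 ‖(z : ℚ_[p])‖ * (p : ℝ) ^ rhoY p z) ^ (k - 1) := by
  by_cases hv : padicValRat p z = 0
  · have hz1 : ‖(z : ℚ_[p])‖ = 1 := by rw [norm_ratCast_eq hz, hv]; simp
    rw [hz1, rhoY, if_pos hv]
    simp only [max_self, Real.rpow_zero, mul_one, one_pow]
    obtain ⟨x, hx⟩ : ∃ x : ℤ_[p], (x : ℚ_[p]) = z := ⟨⟨z, hz1.le⟩, rfl⟩
    have h1 := Ring.map_choose (Rat.castHom ℚ_[p]) z k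
    have h2 := Ring.map_choose (PadicInt.Coe.ringHom (p := p)) x k
    simp only [Rat.coe_castHom] at h1
    rw [h1, ← hx]
    have h3 : Ring.choose (x : ℚ_[p]) k = ((Ring.choose x k : ℤ_[p]) : ℚ_[p]) := h2.symm
    rw [h3]
    exact PadicInt.norm_le_one _
  · rw [rhoY, if_neg hv]
    have hfac : (k.factorial : ℚ_[p]) ≠ 0 := by exact_mod_cast k.factorial_ne_zero
    have h1 := congrArg (fun q : ℚ => ‖(q : ℚ_[p])‖) (factorial_mul_choose z k)
    simp only [Rat.cast_mul, Rat.cast_natCast, norm_mul, Rat.cast_prod, norm_prod, Rat.cast_sub]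
      at h1
    obtain ⟨j, rfl⟩ := Nat.exists_eq_succ_of_ne_zero hk
    rw [Nat.succ_eq_add_one, Finset.prod_range_succ'] at h1
    simp only [Nat.cast_zero, sub_zero] at h1
    have h2 : ∏ i ∈ Finset.range j, ‖(z : ℚ_[p]) - ((i + 1 : ℕ) : ℚ_[p])‖
        ≤ max 1 ‖(z : ℚ_[p])‖ ^ j := by
      calc _ ≤ ∏ i ∈ Finset.range j, max 1 ‖(z : ℚ_[p])‖ := by
            refine Finset.prod_le_prod (fun _ _ => norm_nonneg _) fun i _ => ?_
            rw [sub_eq_add_neg, max_comm]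
            refine (Padic.nonarchimedean _ _).trans (max_le_max le_rfl ?_)
            rw [norm_neg]
            exact_mod_cast Padic.norm_int_le_one (p := p) ((i + 1 : ℕ) : ℤ)
        _ = _ := by simp
    have h3 := norm_factorial_inv_le (p := p) hk
    rw [Nat.succ_eq_add_one, Nat.add_sub_cancel] at h3 ⊢
    have h4 : ‖((Ring.choose z (j + 1) : ℚ) : ℚ_[p])‖ =
        (∏ i ∈ Finset.range j, ‖(z : ℚ_[p]) - ((i + 1 : ℕ) : ℚ_[p])‖) * ‖(z : ℚ_[p])‖ *
          ‖((j + 1).factorial : ℚ_[p])‖⁻¹ := by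
      rw [← h1]
      have := norm_ne_zero_iff.2 hfac
      rw [Nat.succ_eq_add_one] at this
      field_simp
    rw [h4, mul_pow]
    calc _ ≤ max 1 ‖(z : ℚ_[p])‖ ^ j * ‖(z : ℚ_[p])‖ * ((p : ℝ) ^ rho p) ^ j := by gcongr
      _ = _ := by ring

/-- `((1 + ct)^z - 1)/d` preserves discs of radius at most `p^{κ - ρ_p(z)}`, if
`‖c‖ = p^{-κ}/max(1, ‖z‖)` and `‖d‖ = ‖cz‖`. -/
theorem gaussBound_binomialMap {z : ℚ} (hz : z ≠ 0) {c d : ℚ_[p]} {κ : ℕ}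
    (hc : ‖c‖ * max 1 ‖(z : ℚ_[p])‖ = (p : ℝ) ^ (-(κ : ℤ))) (hd : ‖d‖ = ‖c‖ * ‖(z : ℚ_[p])‖)
    {r : ℝ} (hr : 0 ≤ r) (hrκ : r ≤ (p : ℝ) ^ ((κ : ℝ) - rhoY p z)) :
    GaussBound r r (binomialMap c d z) := by
  have hp0 : (0 : ℝ) < p := by exact_mod_cast (Fact.out : p.Prime).pos
  have hzp : ‖(z : ℚ_[p])‖ ≠ 0 := norm_ne_zero_iff.2 (by exact_mod_cast hz)
  have hc0 : ‖c‖ ≠ 0 := by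
    intro h
    rw [h, zero_mul] at hc
    have : (0 : ℝ) < (p : ℝ) ^ (-(κ : ℤ)) := by positivity
    exact this.ne hc
  intro k
  rcases Nat.eq_zero_or_pos k with rfl | hk
  · rw [coeff_zero_eq_constantCoeff_apply, constantCoeff_binomialMap]
    simpa using hr
  · obtain ⟨j, rfl⟩ := Nat.exists_eq_succ_of_ne_zero hk.ne'
    have h1 := norm_choose_le (p := p) hz hk.ne'
    rw [Nat.succ_eq_add_one, Nat.add_sub_cancel] at h1
    rw [Nat.succ_eq_add_one, binomialMap, coeff_C_mul, map_sub, coeff_onePlusPow, coeff_one,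
      if_neg (Nat.succ_ne_zero j), sub_zero, norm_mul, norm_mul, norm_pow, norm_inv, hd]
    have h2 : ‖c‖ * max 1 ‖(z : ℚ_[p])‖ * (p : ℝ) ^ rhoY p z * r ≤ 1 := by
      rw [hc]
      calc _ ≤ (p : ℝ) ^ (-(κ : ℤ)) * (p : ℝ) ^ rhoY p z * (p : ℝ) ^ ((κ : ℝ) - rhoY p z) := by
            gcongr
        _ = 1 := by
            rw [← Real.rpow_intCast, ← Real.rpow_add hp0, ← Real.rpow_add hp0]
            push_cast
            simp
    calc _ ≤ (‖c‖ * ‖(z : ℚ_[p])‖)⁻¹ * (‖c‖ ^ (j + 1) * (‖(z : ℚ_[p])‖ *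
          (max 1 ‖(z : ℚ_[p])‖ * (p : ℝ) ^ rhoY p z) ^ j)) * r ^ (j + 1) := by gcongr
      _ = (‖c‖ * max 1 ‖(z : ℚ_[p])‖ * (p : ℝ) ^ rhoY p z * r) ^ j * r := by
          field_simp
          ring
      _ ≤ 1 * r := by
          gcongr
          exact pow_le_one₀ (by positivity) h2
      _ = r := one_mul r

end Binomial

/-! ### The phase function and its Legendre transform -/

section Phase

open PowerSeries Filter

variable {p : ℕ} [Fact p.Prime]

theorem GaussBound.one_one_of_constantCoeff_eq_zero {r : ℝ} (hr : 1 ≤ r) {f : ℚ_[p]⟦X⟧}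
    (hf : GaussBound r r f) (h0 : constantCoeff f = 0) : GaussBound 1 1 f := by
  intro k
  rw [one_pow, mul_one]
  rcases Nat.eq_zero_or_pos k with rfl | hk
  · rw [coeff_zero_eq_constantCoeff_apply, h0]; simp
  · obtain ⟨j, rfl⟩ := Nat.exists_eq_succ_of_ne_zero hk.ne'
    have h := hf (j + 1)
    rw [pow_succ, ← mul_assoc] at h
    have h1 := (mul_le_iff_le_one_left (show 0 < r by linarith)).1 h
    exact (le_mul_of_one_le_right (norm_nonneg _) (one_le_pow₀ hr)).trans h1

theorem padicValNat_le_sub_two {k : ℕ} (hk : 3 ≤ k) : padicValNat p k ≤ k - 2 := by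
  have h1 : p ^ padicValNat p k ≤ k := Nat.le_of_dvd (by omega) pow_padicValNat_dvd
  have h2 : 2 ^ padicValNat p k ≤ k :=
    (Nat.pow_le_pow_left (Fact.out : p.Prime).two_le _).trans h1
  rcases Nat.lt_or_ge (padicValNat p k) 2 with h | h
  · omega
  · have h3 : padicValNat p k + 2 ≤ 2 ^ padicValNat p k := by
      generalize padicValNat p k = m at h
      induction m, h using Nat.le_induction with
      | base => norm_num
      | succ m hm ih => rw [pow_succ]; omega
    omega

theorem norm_natCast_inv_eq {k : ℕ} (hk : k ≠ 0) :
    ‖(k : ℚ_[p])‖⁻¹ = (p : ℝ) ^ padicValNat p k := by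
  rw [Padic.norm_eq_zpow_neg_valuation (by exact_mod_cast hk), Padic.valuation_natCast, zpow_neg,
    inv_inv, zpow_natCast]

/-- A series with unit linear coefficient and all higher coefficients in `pℤ_p` is an isometry of
`ℤ_p`. -/
theorem norm_evalAt_sub_evalAt {G : ℚ_[p]⟦X⟧} (hG : Restricted G) (hG1 : ‖coeff 1 G‖ = 1)
    (hG2 : ∀ k, 2 ≤ k → ‖coeff k G‖ ≤ (p : ℝ) ^ (-1 : ℤ)) (x y : ℤ_[p]) :
    ‖evalAt p G x - evalAt p G y‖ = ‖x - y‖ := by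
  have hp1 : (1 : ℝ) < p := by exact_mod_cast (Fact.out : p.Prime).one_lt
  rcases eq_or_ne x y with rfl | hxy
  · simp
  have hpos : 0 < ‖x - y‖ := norm_pos_iff.2 (sub_ne_zero.2 hxy)
  have hd : evalAt p G x - evalAt p G y = coeff 1 G * ((x - y : ℤ_[p]) : ℚ_[p]) +
      ∑' k : ℕ, (coeff k G * ((x : ℚ_[p]) ^ k - (y : ℚ_[p]) ^ k) -
        if k = 1 then coeff 1 G * ((x - y : ℤ_[p]) : ℚ_[p]) else 0) := by
    have s1 := hG.summable x.2
    have s2 := hG.summable y.2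
    have s3 := (hasSum_ite_eq (1 : ℕ) (coeff 1 G * ((x - y : ℤ_[p]) : ℚ_[p])))
    have s4 : Summable fun k : ℕ => coeff k G * ((x : ℚ_[p]) ^ k - (y : ℚ_[p]) ^ k) := by
      simpa [mul_sub] using s1.sub s2
    rw [s4.tsum_sub s3.summable, s3.tsum_eq]
    unfold evalAt
    rw [← s1.tsum_sub s2]
    simp_rw [mul_sub]
    ring
  have hrest : ‖∑' k : ℕ, (coeff k G * ((x : ℚ_[p]) ^ k - (y : ℚ_[p]) ^ k) -
        if k = 1 then coeff 1 G * ((x - y : ℤ_[p]) : ℚ_[p]) else 0)‖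
      ≤ (p : ℝ) ^ (-1 : ℤ) * ‖x - y‖ := by
    refine IsUltrametricDist.norm_tsum_le_of_forall_le_of_nonneg (by positivity) fun k => ?_
    rcases Nat.lt_or_ge k 2 with hk | hk
    · interval_cases k
      · simp; positivity
      · simp; positivity
    · rw [if_neg (by omega), sub_zero, norm_mul]
      have : ‖(x : ℚ_[p]) ^ k - (y : ℚ_[p]) ^ k‖ ≤ ‖x - y‖ := by
        obtain ⟨c, hc⟩ := sub_dvd_pow_sub_pow x y k
        have : (x : ℚ_[p]) ^ k - (y : ℚ_[p]) ^ k = ((x ^ k - y ^ k : ℤ_[p]) : ℚ_[p]) := by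
          push_cast; ring
        rw [this, PadicInt.padic_norm_e_of_padicInt, hc, norm_mul]
        exact mul_le_of_le_one_right (norm_nonneg _) (PadicInt.norm_le_one _)
      exact mul_le_mul (hG2 k hk) this (norm_nonneg _) (by positivity)
  have hmain : ‖coeff 1 G * ((x - y : ℤ_[p]) : ℚ_[p])‖ = ‖x - y‖ := by
    rw [norm_mul, hG1, one_mul, PadicInt.padic_norm_e_of_padicInt]
  have hlt : (p : ℝ) ^ (-1 : ℤ) * ‖x - y‖ < ‖x - y‖ := by
    rw [zpow_neg_one]
    exact mul_lt_of_lt_one_left hpos (inv_lt_one_of_one_lt₀ hp1)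
  rw [hd, IsUltrametricDist.norm_add_eq_max_of_norm_ne_norm, hmain, max_eq_left]
  · exact hrest.trans hlt.le
  · rw [hmain]
    exact (hrest.trans_lt hlt).ne'

/-- The combination `(m+δ)^{k+1} - m^{k+1} - (k+1)δm^k - δ^{k+1}` consists of the middle terms of
the binomial expansion. -/
theorem add_pow_sub_sub_sub (m δ : ℚ_[p]) (k : ℕ) (hk : 1 ≤ k) :
    (m + δ) ^ (k + 1) - m ^ (k + 1) - (k + 1) * δ * m ^ k - δ ^ (k + 1) =
      ∑ i ∈ Finset.Ico 2 (k + 1), δ ^ i * m ^ (k + 1 - i) * ((k + 1).choose i : ℚ_[p]) := by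
  rw [add_comm m δ, add_pow, Finset.sum_range_succ, Finset.range_eq_Ico,
    Finset.sum_eq_sum_Ico_succ_bot (by omega), Finset.sum_eq_sum_Ico_succ_bot (by omega)]
  simp only [pow_zero, Nat.sub_zero, Nat.choose_zero_right, Nat.cast_one, zero_add, pow_one,
    Nat.add_sub_cancel, Nat.choose_one_right, Nat.sub_self, Nat.choose_self]
  push_cast
  ring

/-- Modulo `p^N`, the deviation of the antiderivative `H` of `G` from its tangent line at `m` is
`H` itself on the ball of radius `p^{-q}`, whatever `m` is. The hypothesis `hT` bounds the single
terms of the expansion, since `binom(k+1, i)/(k+1) = binom(k, i-1)/i`. -/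
theorem norm_evalAt_antiderivative_add_le {G : ℚ_[p]⟦X⟧} (hG : Restricted G)
    (hH : Restricted (antiderivative G)) (hG0 : constantCoeff G = 0) {N q : ℕ}
    (hT : ∀ i k, 2 ≤ i → i ≤ k → ‖coeff k G‖ * ‖((k.choose (i - 1) : ℕ) : ℚ_[p])‖ *
      ‖(i : ℚ_[p])‖⁻¹ * ((p : ℝ) ^ (-(q : ℤ))) ^ i ≤ (p : ℝ) ^ (-(N : ℤ)))
    (m δ : ℤ_[p]) (hδ : ‖δ‖ ≤ (p : ℝ) ^ (-(q : ℤ))) :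
    ‖evalAt p (antiderivative G) ((m + δ : ℤ_[p]) : ℚ_[p]) - evalAt p (antiderivative G) m -
      (δ : ℚ_[p]) * evalAt p G m - evalAt p (antiderivative G) δ‖ ≤ (p : ℝ) ^ (-(N : ℤ)) := by
  set H := antiderivative G with hHdef
  have hHc : ∀ k, coeff (k + 1) H = coeff k G / ((k : ℚ_[p]) + 1) := by
    intro k
    simp [hHdef, antiderivative]
  have hH0 : coeff 0 H = 0 := by
    rw [coeff_zero_eq_constantCoeff_apply]; exact constantCoeff_antiderivative G
  have hshift : ∀ x : ℤ_[p], HasSum (fun k : ℕ => coeff k G / ((k : ℚ_[p]) + 1) *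
      (x : ℚ_[p]) ^ (k + 1)) (evalAt p H x) := by
    intro x
    have h1 := (hH.summable x.2).hasSum
    rw [← hasSum_nat_add_iff' 1] at h1
    simp only [Finset.sum_range_one, hH0, zero_mul, sub_zero, hHc] at h1
    exact h1
  have hGs : HasSum (fun k : ℕ => coeff k G / ((k : ℚ_[p]) + 1) *
      (((k : ℚ_[p]) + 1) * δ * (m : ℚ_[p]) ^ k)) ((δ : ℚ_[p]) * evalAt p G m) := by
    have h1 := ((hG.summable m.2).hasSum).mul_left (δ : ℚ_[p])
    refine h1.congr_fun ?_
    intro k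
    have : ((k : ℚ_[p]) + 1) ≠ 0 := by exact_mod_cast Nat.succ_ne_zero k
    field_simp
  have hall := (((hshift (m + δ)).sub (hshift m)).sub hGs).sub (hshift δ)
  rw [← hall.tsum_eq]
  have hp0 : (0 : ℝ) < p := by exact_mod_cast (Fact.out : p.Prime).pos
  refine IsUltrametricDist.norm_tsum_le_of_forall_le_of_nonneg (by positivity) fun k => ?_
  rw [← mul_sub, ← mul_sub, ← mul_sub]
  rcases Nat.eq_zero_or_pos k with rfl | hk
  · rw [coeff_zero_eq_constantCoeff_apply, hG0]
    simp
  rw [PadicInt.coe_add, add_pow_sub_sub_sub _ _ _ hk, Finset.mul_sum]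
  refine IsUltrametricDist.norm_sum_le_of_forall_le_of_nonneg (by positivity) fun i hi => ?_
  rw [Finset.mem_Ico] at hi
  have hi0 : (i : ℚ_[p]) ≠ 0 := by
    have : i ≠ 0 := by omega
    exact_mod_cast this
  have hk0 : ((k : ℚ_[p]) + 1) ≠ 0 := by exact_mod_cast Nat.succ_ne_zero k
  have hch : (((k + 1).choose i : ℕ) : ℚ_[p]) * i = ((k : ℚ_[p]) + 1) * (k.choose (i - 1) : ℕ) := by
    have := Nat.add_one_mul_choose_eq k (i - 1)
    rw [Nat.sub_add_cancel (by omega)] at this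
    exact_mod_cast this.symm
  have e : coeff k G / ((k : ℚ_[p]) + 1) *
      ((δ : ℚ_[p]) ^ i * (m : ℚ_[p]) ^ (k + 1 - i) * ((k + 1).choose i : ℚ_[p])) =
      coeff k G * ((k.choose (i - 1) : ℕ) : ℚ_[p]) * (i : ℚ_[p])⁻¹ * (δ : ℚ_[p]) ^ i *
        (m : ℚ_[p]) ^ (k + 1 - i) := by
    field_simp
    linear_combination (coeff k G * (δ : ℚ_[p]) ^ i * (m : ℚ_[p]) ^ (k + 1 - i)) * hch
  rw [e]
  simp only [norm_mul, norm_pow, norm_inv, PadicInt.padic_norm_e_of_padicInt]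
  calc _ ≤ ‖coeff k G‖ * ‖((k.choose (i - 1) : ℕ) : ℚ_[p])‖ * ‖(i : ℚ_[p])‖⁻¹ *
        ((p : ℝ) ^ (-(q : ℤ))) ^ i * 1 := by
        gcongr
        exact pow_le_one₀ (norm_nonneg _) (PadicInt.norm_le_one _)
    _ ≤ _ := by rw [mul_one]; exact hT i k hi.1 (by omega)

/-- The antiderivative of `G` vanishes to second order at zero. Modulo `p^N` it vanishes on balls
of radius `p^{-l}` with `2l ≥ N`, or `2l ≥ N + 1` if `p = 2` because of the denominator `2`. -/
theorem norm_evalAt_antiderivative_le {G : ℚ_[p]⟦X⟧} (hG1 : GaussBound 1 1 G)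
    (hG0 : constantCoeff G = 0) {N l : ℕ} (hl : 1 ≤ l) (hNl : N + padicValNat p 2 ≤ 2 * l)
    (δ : ℤ_[p]) (hδ : ‖δ‖ ≤ (p : ℝ) ^ (-(l : ℤ))) :
    ‖evalAt p (antiderivative G) δ‖ ≤ (p : ℝ) ^ (-(N : ℤ)) := by
  have hp0 : (0 : ℝ) < p := by exact_mod_cast (Fact.out : p.Prime).pos
  have hp1 : (1 : ℝ) < p := by exact_mod_cast (Fact.out : p.Prime).one_lt
  refine norm_evalAt_le (by positivity) fun k => ?_
  rcases Nat.lt_or_ge k 2 with hk | hk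
  · have : coeff k (antiderivative G) = 0 := by
      rw [antiderivative, coeff_mk]
      interval_cases k
      · simp
      · simp [hG0]
    rw [this, zero_mul, norm_zero]
    positivity
  · rw [antiderivative, coeff_mk, norm_mul, norm_div, norm_pow, div_eq_mul_inv,
      norm_natCast_inv_eq (by omega), PadicInt.padic_norm_e_of_padicInt]
    have h1 : ‖coeff (k - 1) G‖ ≤ 1 := by simpa using hG1 (k - 1)
    have h2 : N + padicValNat p k ≤ l * k := by
      rcases Nat.eq_or_lt_of_le hk with rfl | hk
      · linarith
      · have h3 := padicValNat_le_sub_two (p := p) (show 3 ≤ k by omega)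
        obtain ⟨j, rfl⟩ := Nat.exists_eq_add_of_le hk.le
        have : j ≤ l * j := Nat.le_mul_of_pos_left j hl
        rw [mul_add]
        omega
    calc _ ≤ 1 * (p : ℝ) ^ padicValNat p k * ((p : ℝ) ^ (-(l : ℤ))) ^ k := by gcongr
      _ = (p : ℝ) ^ ((padicValNat p k : ℤ) - l * k) := by
          rw [one_mul, ← zpow_natCast, ← zpow_natCast, ← zpow_mul, ← zpow_add₀ hp0.ne']
          congr 1
          ring
      _ ≤ _ := by
          apply zpow_le_zpow_right₀ hp1.le
          have : (N : ℤ) + padicValNat p k ≤ l * k := by exact_mod_cast h2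
          linarith

/-- The antiderivative of the inverse of `G` is, up to sign, the Legendre transform of the
antiderivative of `G`. -/
theorem evalAt_legendre {r : ℝ} (hr : 1 < r) {G φ : ℚ_[p]⟦X⟧} (hG : GaussBound r r G)
    (hφ : GaussBound r r φ) (hφ0 : constantCoeff φ = 0)
    (hGφ : G.subst φ = PowerSeries.X) {x : ℚ_[p]} (hx : ‖x‖ ≤ 1) :
    evalAt p (antiderivative φ) x =
      x * evalAt p φ x - evalAt p (antiderivative G) (evalAt p φ x) := by
  have sφ := hasSubst_of_constantCoeff hφ0
  have hφ1 := hφ.one_one_of_constantCoeff_eq_zero hr.le hφ0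
  have hφr := hφ.restricted hr
  -- both sides vanish at zero and have the derivative `φ + X φ'`
  have formal : (antiderivative G).subst φ + antiderivative φ = PowerSeries.X * φ := by
    apply derivative.ext
    · have h1 : derivative ℚ_[p] ((antiderivative G).subst φ) =
          (derivative ℚ_[p] (antiderivative G)).subst φ * derivative ℚ_[p] φ :=
        derivative_subst sφ
      rw [map_add, h1, derivative_antiderivative, derivative_antiderivative, hGφ,
        Derivation.leibniz, derivative_X]
      simp only [smul_eq_mul]
      ring
    · have h1 : constantCoeff ((antiderivative G).subst φ) = 0 :=
        constantCoeff_subst_eq_zero hφ0 _ (constantCoeff_antiderivative G)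
      rw [map_add, h1, constantCoeff_antiderivative, map_mul, hφ0]
      simp
  have h2 := congrArg (fun s => evalAt p s x) formal
  have hAG := hG.tendsto_antiderivative hr
  have hsub : Restricted ((antiderivative G).subst φ) := by
    have : (antiderivative G).subst φ = PowerSeries.X * φ + C (-1) * antiderivative φ := by
      rw [← formal]; simp
    rw [this]
    exact (Restricted.X.mul hφr).add ((Restricted.C _).mul (hφ.tendsto_antiderivative hr))
  rw [hsub.evalAt_add (hφ.tendsto_antiderivative hr) hx, hAG.evalAt_subst hφr hφ1 hφ0 hx,
    Restricted.X.evalAt_mul hφr hx, evalAt_X] at h2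
  linear_combination h2

end Phase

/-! ### The summation formula for a normalised phase -/

section Summation

open PowerSeries Filter

variable {p : ℕ} [Fact p.Prime]

/-- The decay of the nonlinear coefficients of the derivative of the phase that stationary phase
modulo arbitrary powers of `p` requires. Divisibility by `p` suffices for `p = 3`. For `p = 2` the
quadratic coefficient is divisible by `4` and the later ones by `8`. For `p ≥ 5` the additional
powers of `p` absorb the denominators `i ≤ k` of the expansion of the antiderivative. -/
def TameCoeffs (G : ℚ_[p]⟦X⟧) : Prop :=
  ∀ k, 2 ≤ k → ‖coeff k G‖ ≤ (p : ℝ) ^ (-1 : ℤ) ∧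
    (p = 2 → ‖coeff k G‖ ≤ (p : ℝ) ^ (-(min k 3 : ℕ) : ℤ)) ∧
    (5 ≤ p → ∀ e : ℕ, p ^ e ≤ k → ‖coeff k G‖ ≤ (p : ℝ) ^ (-(1 + e : ℕ) : ℤ))

theorem padicValNat_two_eq : padicValNat p 2 = if p = 2 then 1 else 0 := by
  split_ifs with h
  · subst h; simp
  · exact padicValNat_primes h

theorem TameCoeffs.norm_mul_le {G : ℚ_[p]⟦X⟧} (hG : TameCoeffs G) {N : ℕ} (hN : 1 ≤ N)
    (h2 : p = 2 → 3 ≤ N) (h3 : p = 3 → 2 ≤ N) (i k : ℕ) (hi : 2 ≤ i) (hik : i ≤ k) :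
    ‖coeff k G‖ * ‖((k.choose (i - 1) : ℕ) : ℚ_[p])‖ * ‖(i : ℚ_[p])‖⁻¹ *
      ((p : ℝ) ^ (-(((N - padicValNat p 2) / 2 : ℕ) : ℤ))) ^ i ≤ (p : ℝ) ^ (-(N : ℤ)) := by
  have hpp := (Fact.out : p.Prime)
  have hp0 : (0 : ℝ) < p := by exact_mod_cast hpp.pos
  have hp1 : (1 : ℝ) ≤ p := by exact_mod_cast hpp.one_lt.le
  obtain ⟨hk1, hk2, hk5⟩ := hG k (hi.trans hik)
  set q := (N - padicValNat p 2) / 2 with hq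
  -- it suffices to compare exponents of `p`
  have main : ∀ a b : ℕ, ‖coeff k G‖ ≤ (p : ℝ) ^ (-(a : ℤ)) →
      ‖((k.choose (i - 1) : ℕ) : ℚ_[p])‖ ≤ (p : ℝ) ^ (-(b : ℤ)) →
      N + padicValNat p i ≤ a + b + q * i →
      ‖coeff k G‖ * ‖((k.choose (i - 1) : ℕ) : ℚ_[p])‖ * ‖(i : ℚ_[p])‖⁻¹ *
        ((p : ℝ) ^ (-(q : ℤ))) ^ i ≤ (p : ℝ) ^ (-(N : ℤ)) := by
    intro a b ha hb hab
    rw [norm_natCast_inv_eq (by omega)]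
    calc _ ≤ (p : ℝ) ^ (-(a : ℤ)) * (p : ℝ) ^ (-(b : ℤ)) * (p : ℝ) ^ padicValNat p i *
          ((p : ℝ) ^ (-(q : ℤ))) ^ i := by gcongr
      _ = (p : ℝ) ^ (-(a : ℤ) - b + padicValNat p i - q * i) := by
          rw [← zpow_natCast, ← zpow_natCast, ← zpow_mul, ← zpow_add₀ hp0.ne',
            ← zpow_add₀ hp0.ne', ← zpow_add₀ hp0.ne']
          congr 1
          ring
      _ ≤ _ := by
          apply zpow_le_zpow_right₀ hp1
          have : (N : ℤ) + padicValNat p i ≤ a + b + q * i := by exact_mod_cast hab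
          linarith
  have hb0 : ‖((k.choose (i - 1) : ℕ) : ℚ_[p])‖ ≤ (p : ℝ) ^ (-((0 : ℕ) : ℤ)) := by
    have := Padic.norm_int_le_one (p := p) ((k.choose (i - 1) : ℕ) : ℤ)
    simpa using this
  have hvi : 3 ≤ i → padicValNat p i + 2 ≤ i := by
    intro h
    have := padicValNat_le_sub_two (p := p) h
    omega
  obtain ⟨j, rfl⟩ := Nat.exists_eq_add_of_le hi
  rw [padicValNat_two_eq] at hq
  have hqj : 1 ≤ q → j ≤ q * j := fun h => Nat.le_mul_of_pos_left j h
  have hqi : q * (2 + j) = 2 * q + q * j := by ring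
  rcases eq_or_ne p 2 with hp2 | hp2
  · rw [if_pos hp2] at hq
    have hN3 := h2 hp2
    have hq1 : 1 ≤ q := by omega
    have := hqj hq1
    have hG2 := hk2 hp2
    rcases Nat.eq_zero_or_pos j with rfl | hj
    · -- `i = 2`: the binomial coefficient is `k`, which is even when `k = 2`
      have hv : padicValNat p (2 + 0) = 1 := by rw [Nat.add_zero, padicValNat_two_eq, if_pos hp2]
      rcases Nat.eq_or_lt_of_le hik with rfl | hk3
      · refine main 2 1 (by simpa using hG2) ?_ (by omega)
        have : ((2 + 0).choose (2 + 0 - 1) : ℕ) = p := by rw [hp2]; rfl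
        rw [this, Padic.norm_p]
        simp
      · rw [min_eq_right (by omega)] at hG2
        exact main 3 0 hG2 hb0 (by omega)
    · rw [min_eq_right (by omega)] at hG2
      have := hvi (by omega)
      exact main 3 0 hG2 hb0 (by omega)
  · rw [if_neg hp2] at hq
    rcases Nat.lt_or_ge p 5 with hp5 | hp5
    · have hp3 : p = 3 := by
        have := hpp.two_le
        have : p ≠ 4 := by rintro h; rw [h] at hpp; revert hpp; norm_num
        omega
      have hN2 := h3 hp3
      have hq1 : 1 ≤ q := by omega
      have := hqj hq1
      refine main 1 0 hk1 hb0 ?_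
      rcases Nat.eq_zero_or_pos j with rfl | hj
      · have hv : padicValNat p (2 + 0) = 0 := by
          rw [Nat.add_zero, padicValNat_two_eq, if_neg hp2]
        omega
      · have := hvi (by omega)
        omega
    · refine main (1 + padicValNat p (2 + j)) 0 (hk5 hp5 _ ?_) hb0 (by omega)
      exact (Nat.le_of_dvd (by omega) pow_padicValNat_dvd).trans hik

/-- The complete exponential sums attached to the phase `H = ∫ G` are, up to a constant of
absolute value `p^{N/2}`, exponentials of the antiderivative of the inverse of `G`. -/
theorem finiteFourier_antiderivative {r : ℝ} (hr : 1 < r) {G φ : ℚ_[p]⟦X⟧}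
    (hG : GaussBound r r G) (hG0 : constantCoeff G = 0) (hG1 : ‖coeff 1 G‖ = 1)
    (hGt : TameCoeffs G) (hφ : GaussBound r r φ) (hφ0 : constantCoeff φ = 0)
    (hGφ : G.subst φ = PowerSeries.X) {N : ℕ} (hN : 1 ≤ N) (h2 : p = 2 → 3 ≤ N)
    (h3 : p = 3 → 2 ≤ N) :
    (∀ x y : ℤ_[p], ‖x - y‖ ≤ (p : ℝ) ^ (-(N : ℤ)) →
      eP p (evalAt p (antiderivative G) x / (p : ℚ_[p]) ^ N) =
        eP p (evalAt p (antiderivative G) y / (p : ℚ_[p]) ^ N)) ∧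
    ∃ K : ℂ, ‖K‖ ^ 2 = (p : ℝ) ^ N ∧ ∀ t : ℤ,
      finiteFourier N (fun x : ℤ_[p] => eP p (evalAt p (antiderivative G) x / (p : ℚ_[p]) ^ N)) t =
        K * eP p (-evalAt p (antiderivative φ) t / (p : ℚ_[p]) ^ N) := by
  have hGr := hG.restricted hr
  have hφr := hφ.restricted hr
  have hG11 := hG.one_one_of_constantCoeff_eq_zero hr.le hG0
  have hφ11 := hφ.one_one_of_constantCoeff_eq_zero hr.le hφ0
  have ht1 : ∀ t : ℤ, ‖(t : ℚ_[p])‖ ≤ 1 := Padic.norm_int_le_one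
  have hp2 : padicValNat p 2 ≤ 1 := by rw [padicValNat_two_eq]; split_ifs <;> omega
  have hp2' : padicValNat p 2 = 1 → 3 ≤ N := by
    intro h
    rw [padicValNat_two_eq] at h
    split_ifs at h with hp
    exact h2 hp
  set q := (N - padicValNat p 2) / 2 with hq
  let Gf : ℤ_[p] → ℤ_[p] := fun x => ⟨evalAt p G x, norm_evalAt_le_one hG11 x.2⟩
  let φf : ℤ → ℤ_[p] := fun t => ⟨evalAt p φ t, norm_evalAt_le_one hφ11 (ht1 t)⟩
  have hGφf : ∀ t : ℤ, evalAt p G (φf t) = t := by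
    intro t
    have := hGr.evalAt_subst hφr hφ11 hφ0 (ht1 t)
    rw [hGφ, evalAt_X] at this
    exact this.symm
  have key := finiteFourier_stationaryPhase (p := p) (N := N) (q := q) (by omega)
    (H := fun x => evalAt p (antiderivative G) x) (G := Gf) (φ := φf)
    (norm_evalAt_antiderivative_add_le hGr (hG.tendsto_antiderivative hr) hG0
      (hGt.norm_mul_le hN h2 h3))
    (norm_evalAt_antiderivative_le hG11 hG0 (by omega) (by omega))
    (fun a t => by
      rw [← norm_evalAt_sub_evalAt hGr hG1 (fun k hk => (hGt k hk).1) a (φf t), hGφf,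
        ← PadicInt.padic_norm_e_of_padicInt, PadicInt.coe_sub, PadicInt.coe_intCast])
  refine ⟨key.1, ?_⟩
  obtain ⟨K, hK, hKt⟩ := key.2
  refine ⟨K, hK, fun t => ?_⟩
  rw [hKt]
  have := evalAt_legendre hr hG hφ hφ0 hGφ (ht1 t)
  congr 2
  rw [this]
  simp only [φf]
  ring

/-- The summation formula for a phase `f` with `f' = f'(0) + p^v G` and its dual
`f(0) - p^v ∫ G⁻¹`. -/
theorem summation_formula {r : ℝ} (hr : 1 < r) {f G φ : ℚ_[p]⟦X⟧} {v : ℤ}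
    (hf : derivative ℚ_[p] f = C (constantCoeff (derivative ℚ_[p] f)) + C ((p : ℚ_[p]) ^ v) * G)
    (hG : GaussBound r r G) (hG0 : constantCoeff G = 0) (hG1 : ‖coeff 1 G‖ = 1)
    (hGt : TameCoeffs G) (hφ : GaussBound r r φ) (hφ0 : constantCoeff φ = 0)
    (hGφ : G.subst φ = PowerSeries.X) {N n : ℕ} (hNn : (N : ℤ) = n - v) (hN : 1 ≤ N)
    (h2 : p = 2 → 3 ≤ N) (h3 : p = 3 → 2 ≤ N) :
    ∃ ε : ℂ, ‖ε‖ = 1 ∧ ∀ (B : ℝ), 0 < B → ∀ (h : 𝓢(ℝ, ℂ)) (a : ℚ), IsPFraction p a →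
      ‖(a : ℚ_[p]) - constantCoeff (derivative ℚ_[p] f)‖ ≤ (p : ℝ) ^ (-(n : ℤ)) →
      Summable (fun m : ℤ => eP p (evalAt p f (m : ℚ_[p]) / (p : ℚ_[p]) ^ n) * h ((m : ℝ) / B)) ∧
      Summable (fun t : ℤ =>
        eP p (evalAt p (C (constantCoeff f) - C ((p : ℚ_[p]) ^ v) * antiderivative φ) (t : ℚ_[p]) /
          (p : ℚ_[p]) ^ n) * hHat p h a n B ((t : ℝ) / ((p : ℝ) ^ (N : ℤ) / B))) ∧
      ∑' m : ℤ, eP p (evalAt p f (m : ℚ_[p]) / (p : ℚ_[p]) ^ n) * h ((m : ℝ) / B) =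
        ε * (B : ℂ) / (((p : ℝ) ^ ((N : ℝ) / 2) : ℝ) : ℂ) *
          ∑' t : ℤ, eP p (evalAt p (C (constantCoeff f) - C ((p : ℚ_[p]) ^ v) * antiderivative φ)
            (t : ℚ_[p]) / (p : ℚ_[p]) ^ n) *
              hHat p h a n B ((t : ℝ) / ((p : ℝ) ^ (N : ℤ) / B)) := by
  have hpp := (Fact.out : p.Prime)
  have hp0 : (0 : ℝ) < p := by exact_mod_cast hpp.pos
  have hpQ : (p : ℚ_[p]) ≠ 0 := by exact_mod_cast hpp.ne_zero
  have hpC : (p : ℂ) ≠ 0 := by exact_mod_cast hpp.ne_zero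
  have ht1 : ∀ t : ℤ, ‖(t : ℚ_[p])‖ ≤ 1 := Padic.norm_int_le_one
  have hAG := hG.tendsto_antiderivative hr
  have hAφ := hφ.tendsto_antiderivative hr
  set b := constantCoeff (derivative ℚ_[p] f) with hb
  set f0 := constantCoeff f with hf0
  have hscale : ∀ x : ℚ_[p], (p : ℚ_[p]) ^ v * x / (p : ℚ_[p]) ^ n = x / (p : ℚ_[p]) ^ N := by
    intro x
    have : (p : ℚ_[p]) ^ n = (p : ℚ_[p]) ^ v * (p : ℚ_[p]) ^ N := by
      rw [← zpow_natCast, ← zpow_natCast, ← zpow_add₀ hpQ, hNn]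
      congr 1
      ring
    rw [this, mul_div_mul_left _ _ (zpow_ne_zero _ hpQ)]
  -- integrate the decomposition of `f'`
  have hfeq : f = C f0 + (C b * PowerSeries.X + C ((p : ℚ_[p]) ^ v) * antiderivative G) := by
    apply derivative.ext
    · rw [hf, map_add, map_add, Derivation.leibniz, Derivation.leibniz, derivative_C, derivative_C,
        derivative_C, derivative_X, derivative_antiderivative]
      simp
    · simp [constantCoeff_antiderivative, hf0]
  have hfev : ∀ m : ℤ, evalAt p f (m : ℚ_[p]) / (p : ℚ_[p]) ^ n =
      f0 / (p : ℚ_[p]) ^ n + (b * m / (p : ℚ_[p]) ^ n +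
        evalAt p (antiderivative G) m / (p : ℚ_[p]) ^ N) := by
    intro m
    have hCX := (Restricted.C b).mul Restricted.X
    have hCA := (Restricted.C ((p : ℚ_[p]) ^ v)).mul hAG
    rw [hfeq, (Restricted.C f0).evalAt_add (hCX.add hCA) (ht1 m), hCX.evalAt_add hCA (ht1 m),
      evalAt_C, evalAt_C_mul, evalAt_C_mul, evalAt_X, add_div, add_div, hscale]
  have hfdev : ∀ t : ℤ,
      evalAt p (C f0 - C ((p : ℚ_[p]) ^ v) * antiderivative φ) (t : ℚ_[p]) / (p : ℚ_[p]) ^ n =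
        f0 / (p : ℚ_[p]) ^ n + -evalAt p (antiderivative φ) t / (p : ℚ_[p]) ^ N := by
    intro t
    have hCA := (Restricted.C (-(p : ℚ_[p]) ^ v)).mul hAφ
    rw [sub_eq_add_neg, ← neg_mul, ← map_neg,
      (Restricted.C f0).evalAt_add hCA (ht1 t), evalAt_C, evalAt_C_mul, add_div, neg_mul,
      ← mul_neg, hscale]
  obtain ⟨hper, K, hK, hKt⟩ := finiteFourier_antiderivative hr hG hG0 hG1 hGt hφ hφ0 hGφ hN h2 h3
  set F : ℤ_[p] → ℂ := fun x => eP p (evalAt p (antiderivative G) x / (p : ℚ_[p]) ^ N) with hF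
  have hM : 0 < p ^ N := pow_pos hpp.pos N
  have hpN2 : ((p : ℝ) ^ ((N : ℝ) / 2)) ^ 2 = (p : ℝ) ^ N := by
    rw [← Real.rpow_natCast, ← Real.rpow_mul hp0.le]
    push_cast
    rw [div_mul_cancel₀ _ two_ne_zero, Real.rpow_natCast]
  have hpN0 : (0 : ℝ) < (p : ℝ) ^ ((N : ℝ) / 2) := by positivity
  have hK0 : ‖K‖ = (p : ℝ) ^ ((N : ℝ) / 2) := by
    rw [← sq_eq_sq₀ (norm_nonneg _) hpN0.le, hK, hpN2]
  refine ⟨K / (((p : ℝ) ^ ((N : ℝ) / 2) : ℝ) : ℂ), ?_, ?_⟩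
  · rw [norm_div, hK0, Complex.norm_real, Real.norm_of_nonneg hpN0.le, div_self hpN0.ne']
  intro B hB h a ha hab
  have hhat : ∀ t : ℤ, hHat p h a n B ((t : ℝ) / ((p : ℝ) ^ (N : ℤ) / B)) =
      𝓕 (h : ℝ → ℂ) (-(B * t / ((p ^ N : ℕ) : ℝ)) - B * ((a : ℝ) / (p : ℝ) ^ n)) := by
    intro t
    unfold hHat
    push_cast
    rw [zpow_natCast]
    field_simp
  have hlin : ∀ m : ℤ, eP p (b * m / (p : ℚ_[p]) ^ n) =
      Complex.exp (2 * Real.pi * Complex.I * (m * ((a : ℝ) / (p : ℝ) ^ n) : ℝ)) := by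
    intro m
    rw [eP_eq p (ha.mul_int_div_pow m n)]
    · congr 1
      push_cast
      ring
    · have : b * m / (p : ℚ_[p]) ^ n - ((a * m / (p : ℚ) ^ n : ℚ) : ℚ_[p]) =
          (-(m : ℚ_[p]) * ((a : ℚ_[p]) - b)) / (p : ℚ_[p]) ^ n := by
        push_cast
        ring
      rw [this, norm_div_pow_le_one_iff, norm_mul, norm_neg]
      exact (mul_le_of_le_one_left (norm_nonneg _) (ht1 m)).trans hab
  have hS : ∀ t k : ℤ, finiteFourier N F (t + (p ^ N : ℕ) * k) = finiteFourier N F t :=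
    finiteFourier_periodic N F
  have hinv : ∀ m : ℤ, F m = (((p ^ N : ℕ) : ℂ))⁻¹ * ∑ t ∈ Finset.range (p ^ N),
      finiteFourier N F t *
        Complex.exp (2 * Real.pi * Complex.I * (m * (t / ((p ^ N : ℕ) : ℝ)) : ℝ)) := by
    intro m
    have h1 := finiteFourier_inversion hper m
    have h4 : ∀ t : ℕ, eP p ((t : ℚ_[p]) * (m : ℚ_[p]) / (p : ℚ_[p]) ^ N) =
        Complex.exp (2 * Real.pi * Complex.I * (m * (t / ((p ^ N : ℕ) : ℝ)) : ℝ)) := by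
      intro t
      rw [eP_eq p (r := (t * m : ℤ) / (p : ℚ) ^ N) ⟨_, _, rfl⟩ (by push_cast; simp)]
      congr 1
      push_cast
      ring
    simp_rw [h4] at h1
    rw [h1]
    push_cast
    rw [← mul_assoc, inv_mul_cancel₀ (pow_ne_zero _ hpC), one_mul]
    simp [hF]
  have hsumm := SchwartzMap.summable_periodic_mul_fourier h hB ((a : ℝ) / (p : ℝ) ^ n) hM hS
  have hpois := SchwartzMap.tsum_periodic_mul_eq h hB ((a : ℝ) / (p : ℝ) ^ n) hM
    (F := fun m : ℤ => F m) hS hinv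
  have hK' : K ≠ 0 := by
    rw [← norm_ne_zero_iff, hK0]; exact hpN0.ne'
  -- the dual weights are the finite Fourier coefficients, up to a constant
  have hdual : ∀ t : ℤ,
      eP p (evalAt p (C f0 - C ((p : ℚ_[p]) ^ v) * antiderivative φ) (t : ℚ_[p]) /
        (p : ℚ_[p]) ^ n) * hHat p h a n B ((t : ℝ) / ((p : ℝ) ^ (N : ℤ) / B)) =
      (eP p (f0 / (p : ℚ_[p]) ^ n) * K⁻¹) * (finiteFourier N F t *
        𝓕 (h : ℝ → ℂ) (-(B * t / ((p ^ N : ℕ) : ℝ)) - B * ((a : ℝ) / (p : ℝ) ^ n))) := by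
    intro t
    rw [hhat, hfdev, eP_add, hKt]
    field_simp
  refine ⟨SchwartzMap.summable_bounded_mul h hB fun m => (norm_eP _).le, ?_, ?_⟩
  · simp_rw [hdual]
    exact hsumm.mul_left _
  · simp_rw [hdual]
    rw [tsum_mul_left]
    have h5 : ∀ m : ℤ, eP p (evalAt p f (m : ℚ_[p]) / (p : ℚ_[p]) ^ n) * h ((m : ℝ) / B) =
        eP p (f0 / (p : ℚ_[p]) ^ n) * (F m * (Complex.exp
          (2 * Real.pi * Complex.I * (m * ((a : ℝ) / (p : ℝ) ^ n) : ℝ)) * h (m / B))) := by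
      intro m
      rw [hfev, eP_add, eP_add, hlin]
      simp only [hF, PadicInt.coe_intCast]
      ring
    simp_rw [h5]
    rw [tsum_mul_left, hpois]
    have h6 : (((p : ℝ) ^ ((N : ℝ) / 2) : ℝ) : ℂ) * (((p : ℝ) ^ ((N : ℝ) / 2) : ℝ) : ℂ) =
        ((p ^ N : ℕ) : ℂ) := by
      rw [← sq]
      exact_mod_cast hpN2
    rw [← h6]
    have h7 : (((p : ℝ) ^ ((N : ℝ) / 2) : ℝ) : ℂ) ≠ 0 := by exact_mod_cast hpN0.ne'
    generalize ∑' t : ℤ, finiteFourier N F t * _ = T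
    field_simp

end Summation

/-! ### The dual series and its class -/

section Dual

open PowerSeries Filter

variable {p : ℕ} [Fact p.Prime]

/-- The exponent `v` with `‖f''(0)‖ = p^{-v}`; it is `0` if `f''(0) = 0`. -/
noncomputable def phaseExponent (f : ℚ_[p]⟦X⟧) : ℤ := (coeff 1 (derivative ℚ_[p] f)).valuation

/-- The series `p^{-v} (f' - f'(0))`, whose linear coefficient is a unit if `f''(0) ≠ 0`. -/
noncomputable def normalizedDerivative (f : ℚ_[p]⟦X⟧) : ℚ_[p]⟦X⟧ :=
  C ((p : ℚ_[p]) ^ (-phaseExponent f)) *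
    (derivative ℚ_[p] f - C (constantCoeff (derivative ℚ_[p] f)))

open Classical in
/-- The dual series `f(0) - p^v ∫ φ`, where `φ` is the compositional inverse of
`p^{-v} (f' - f'(0))`; it is `0` if `f''(0) = 0`, in which case there is no such inverse. -/
noncomputable def dualSeries (f : ℚ_[p]⟦X⟧) : ℚ_[p]⟦X⟧ :=
  if h : IsUnit (coeff 1 (normalizedDerivative f)) then
    C (constantCoeff f) - C ((p : ℚ_[p]) ^ phaseExponent f) *
      antiderivative ((normalizedDerivative f).substInvOfIsUnit h)
  else 0

theorem phaseExponent_eq {f G : ℚ_[p]⟦X⟧} {v : ℤ} (hG1 : ‖coeff 1 G‖ = 1)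
    (hf : derivative ℚ_[p] f = C (constantCoeff (derivative ℚ_[p] f)) + C ((p : ℚ_[p]) ^ v) * G) :
    phaseExponent f = v := by
  have hp1 : (1 : ℝ) < p := by exact_mod_cast (Fact.out : p.Prime).one_lt
  have h1 : ‖coeff 1 (derivative ℚ_[p] f)‖ = (p : ℝ) ^ (-v) := by
    rw [hf, map_add, coeff_C_mul, coeff_C, if_neg one_ne_zero, zero_add, norm_mul, hG1, mul_one,
      Padic.norm_p_zpow]
  have h0 : coeff 1 (derivative ℚ_[p] f) ≠ 0 := by
    rw [← norm_ne_zero_iff, h1]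
    positivity
  rw [Padic.norm_eq_zpow_neg_valuation h0] at h1
  have := zpow_right_injective₀ (by linarith) hp1.ne' h1
  exact neg_injective this

theorem normalizedDerivative_eq {f G : ℚ_[p]⟦X⟧} {v : ℤ} (hG1 : ‖coeff 1 G‖ = 1)
    (hf : derivative ℚ_[p] f = C (constantCoeff (derivative ℚ_[p] f)) + C ((p : ℚ_[p]) ^ v) * G) :
    normalizedDerivative f = G := by
  have hpQ : (p : ℚ_[p]) ≠ 0 := by exact_mod_cast (Fact.out : p.Prime).ne_zero
  rw [normalizedDerivative, phaseExponent_eq hG1 hf, sub_eq_iff_eq_add'.2 hf, ← mul_assoc,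
    ← map_mul, ← zpow_add₀ hpQ, neg_add_cancel, zpow_zero, map_one, one_mul]

/-- A norm in `ℚ_p` is an integral power of `p`, so that a bound by a real power of `p` can be
rounded. -/
theorem norm_le_zpow_of_lt {x : ℚ_[p]} {t : ℝ} {a : ℤ} (h : ‖x‖ ≤ (p : ℝ) ^ (-t))
    (hat : (a : ℝ) - 1 < t) : ‖x‖ ≤ (p : ℝ) ^ (-a) := by
  have hp1 : (1 : ℝ) < p := by exact_mod_cast (Fact.out : p.Prime).one_lt
  rcases eq_or_ne x 0 with rfl | hx
  · rw [norm_zero]; positivity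
  rw [Padic.norm_eq_zpow_neg_valuation hx] at h ⊢
  rw [← Real.rpow_intCast, Real.rpow_le_rpow_left_iff hp1] at h
  push_cast at h
  apply zpow_le_zpow_right₀ hp1.le
  have : ((a - 1 : ℤ) : ℝ) < x.valuation := by push_cast; linarith
  have := Int.cast_lt.1 this
  omega

theorem GaussBound.norm_coeff_le {t M : ℝ} {f : ℚ_[p]⟦X⟧} (hf : GaussBound ((p : ℝ) ^ t) M f)
    (k : ℕ) : ‖coeff k f‖ ≤ M * (p : ℝ) ^ (-(k * t)) := by
  have hp0 : (0 : ℝ) < p := by exact_mod_cast (Fact.out : p.Prime).pos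
  have h := hf k
  rw [← Real.rpow_mul_natCast hp0.le] at h
  rw [Real.rpow_neg hp0.le, ← div_eq_mul_inv, le_div_iff₀ (by positivity), mul_comm (k : ℝ)]
  exact h

theorem gaussBound_of_mem_I0Lam {lam : ℝ} {g : ℚ_[p]⟦X⟧} (hg : g ∈ I0Lam p lam) :
    GaussBound ((p : ℝ) ^ lam) 1 g := by
  have hp0 : (0 : ℝ) < p := by exact_mod_cast (Fact.out : p.Prime).pos
  have hp1 : (1 : ℝ) < p := by exact_mod_cast (Fact.out : p.Prime).one_lt
  intro k
  rw [← Real.rpow_mul_natCast hp0.le]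
  calc _ ≤ (p : ℝ) ^ (-⌈(k : ℝ) * lam⌉) * (p : ℝ) ^ (lam * k) := by
        gcongr
        exact hg.2 k
    _ ≤ 1 := by
        rw [← Real.rpow_intCast, ← Real.rpow_add hp0]
        apply Real.rpow_le_one_of_one_le_of_nonpos hp1.le
        push_cast
        have := Int.le_ceil ((k : ℝ) * lam)
        linarith

theorem mem_I0Lam_of_gaussBound {lam : ℝ} (hlam : 0 < lam) {g : ℚ_[p]⟦X⟧}
    (hg : GaussBound ((p : ℝ) ^ lam) 1 g) : g ∈ I0Lam p lam := by
  have hp1 : (1 : ℝ) < p := by exact_mod_cast (Fact.out : p.Prime).one_lt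
  have hr : 1 < (p : ℝ) ^ lam := Real.one_lt_rpow hp1 hlam
  refine ⟨⟨fun k => ?_, tendsto_zero_iff_norm_tendsto_zero.1 (hg.restricted hr)⟩, fun k => ?_⟩
  · exact (le_mul_of_one_le_right (norm_nonneg _) (one_le_pow₀ hr.le)).trans (hg k)
  · refine norm_le_zpow_of_lt (t := k * lam) ?_ ?_
    · simpa using hg.norm_coeff_le k
    · have := Int.ceil_lt_add_one ((k : ℝ) * lam)
      linarith

/-- A convergent series is a scalar multiple of a series in `𝐈₀(ℤ_p)`. -/
theorem Restricted.exists_eq_C_mul {f : ℚ_[p]⟦X⟧} (hf : Restricted f) :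
    ∃ c : ℚ_[p], c ≠ 0 ∧ ∃ a ∈ I0 p, f = PowerSeries.C c * a := by
  have hp1 : (1 : ℝ) < p := by exact_mod_cast (Fact.out : p.Prime).one_lt
  have hpQ : (p : ℚ_[p]) ≠ 0 := by exact_mod_cast (Fact.out : p.Prime).ne_zero
  have hfn := tendsto_zero_iff_norm_tendsto_zero.1 hf
  obtain ⟨M, hM⟩ := hfn.bddAbove_range
  obtain ⟨j, hj⟩ := pow_unbounded_of_one_lt M hp1
  have hc : ((p : ℚ_[p]) ^ j)⁻¹ ≠ 0 := inv_ne_zero (pow_ne_zero _ hpQ)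
  refine ⟨((p : ℚ_[p]) ^ j)⁻¹, hc, PowerSeries.C ((p : ℚ_[p]) ^ j) * f, ⟨fun k => ?_, ?_⟩, ?_⟩
  · rw [coeff_C_mul, norm_mul, norm_pow, Padic.norm_p, inv_pow]
    rw [inv_mul_le_iff₀ (by positivity), mul_one]
    exact (hM ⟨k, rfl⟩).trans hj.le
  · have h := hfn.const_mul ‖(p : ℚ_[p]) ^ j‖
    rw [mul_zero] at h
    exact h.congr fun k => by rw [coeff_C_mul, norm_mul]
  · rw [← mul_assoc, ← map_mul, inv_mul_cancel₀ (pow_ne_zero _ hpQ), map_one, one_mul]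

theorem rho_pos : 0 < rho p := by
  have hp1 : (1 : ℝ) < p := by exact_mod_cast (Fact.out : p.Prime).one_lt
  rw [rho]
  apply div_pos one_pos
  linarith

theorem rhoY_le_rho (y : ℚ) : rhoY p y ≤ rho p := by
  rw [rhoY]
  split_ifs
  · exact rho_pos.le
  · exact le_rfl

omit [Fact p.Prime] in
theorem rhoY_neg (y : ℚ) : rhoY p (-y) = rhoY p y := by
  simp [rhoY]

theorem rhoY_inv (y : ℚ) : rhoY p y⁻¹ = rhoY p y := by
  simp [rhoY, padicValRat.inv]

theorem le_iota'_natCast {m j : ℕ} (hm : m ≠ 0) (h : p ^ j ∣ m) : (j : ℤ) ≤ iota' p m := by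
  rw [iota', padicValRat.of_nat]
  have : j ≤ padicValNat p m := (padicValNat_dvd_iff_le hm).1 h
  exact le_max_of_le_right (by exact_mod_cast this)

theorem lamTilde_eq_mul_rho {y : ℚ} {κ : ℕ} {lam : ℝ} (hlam : ∃ k : ℕ, 0 < k ∧ lam = k * rho p)
    (hpos : 0 < lamTilde p y κ lam) : ∃ k : ℕ, 0 < k ∧ lamTilde p y κ lam = k * rho p := by
  have hp := (Fact.out : p.Prime)
  have hp1 : (1 : ℝ) < p := by exact_mod_cast hp.one_lt
  have hκ : (κ : ℝ) = (κ * (p - 1) : ℕ) * rho p := by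
    rw [rho]
    push_cast [hp.one_lt.le]
    have : (p : ℝ) - 1 ≠ 0 := by linarith
    field_simp
  rw [lamTilde] at hpos ⊢
  rcases min_cases ((κ : ℝ) - rhoY p y) lam with ⟨h, _⟩ | ⟨h, _⟩
  · rw [h] at hpos ⊢
    rw [rhoY] at hpos ⊢
    split_ifs at hpos ⊢ with hv
    · refine ⟨κ * (p - 1), ?_, by rw [sub_zero]; exact hκ⟩
      rw [sub_zero] at hpos
      have h1 : 0 < κ := by exact_mod_cast hpos
      have := hp.one_lt
      exact Nat.mul_pos h1 (by omega)
    · have h1 : 1 < κ * (p - 1) := by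
        rw [hκ, sub_pos] at hpos
        have := (lt_mul_iff_one_lt_left rho_pos).1 hpos
        exact_mod_cast this
      refine ⟨κ * (p - 1) - 1, by omega, ?_⟩
      rw [Nat.cast_sub h1.le, sub_mul, ← hκ]
      simp
  · rw [h]; exact hlam

/-- A sum of two series, one as small as a binomial series and one as small as the error term of
the class, has the decay needed for stationary phase. -/
theorem tameCoeffs_add {P E : ℚ_[p]⟦X⟧} {μ lam : ℝ} {κ : ℕ} {s : ℤ}
    (hμ : (κ : ℝ) - rho p ≤ μ) (hκ : 1 ≤ κ) (hκ2 : p = 2 → 3 ≤ κ) (hlam : rho p ≤ lam) (hs : 1 ≤ s)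
    (hP : GaussBound ((p : ℝ) ^ μ) ((p : ℝ) ^ μ) P)
    (hE : GaussBound ((p : ℝ) ^ lam) ((p : ℝ) ^ (-(s : ℝ)) * (p : ℝ) ^ lam) E) :
    (∀ k, 1 ≤ k → ‖coeff k P‖ ≤ 1 ∧ ‖coeff k E‖ ≤ (p : ℝ) ^ (-1 : ℤ)) ∧ TameCoeffs (P + E) := by
  have hp := (Fact.out : p.Prime)
  have hp0 : (0 : ℝ) < p := by exact_mod_cast hp.pos
  have hp1 : (1 : ℝ) < p := by exact_mod_cast hp.one_lt
  have hp2 : (2 : ℝ) ≤ p := by exact_mod_cast hp.two_le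
  have hκR : (1 : ℝ) ≤ κ := by exact_mod_cast hκ
  have hsR : (1 : ℝ) ≤ s := by exact_mod_cast hs
  have hρ : rho p * ((p : ℝ) - 1) = 1 := by
    rw [rho, one_div_mul_cancel]; linarith
  have hρ0 := rho_pos (p := p)
  have hρ1 : rho p ≤ 1 := by nlinarith
  have hPk : ∀ k : ℕ, ‖coeff k P‖ ≤ (p : ℝ) ^ (-(((k : ℝ) - 1) * μ)) := by
    intro k
    refine (hP.norm_coeff_le k).trans_eq ?_
    rw [← Real.rpow_add hp0]
    congr 1
    ring
  have hEk : ∀ k : ℕ, ‖coeff k E‖ ≤ (p : ℝ) ^ (-((s : ℝ) + ((k : ℝ) - 1) * lam)) := by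
    intro k
    refine (hE.norm_coeff_le k).trans_eq ?_
    rw [← Real.rpow_add hp0, ← Real.rpow_add hp0]
    congr 1
    ring
  have hμ0 : 0 ≤ μ := by linarith
  have hlam0 : 0 < lam := by linarith
  have hsum : ∀ (k : ℕ) (a : ℤ), (a : ℝ) - 1 < ((k : ℝ) - 1) * μ →
      (a : ℝ) - 1 < s + ((k : ℝ) - 1) * lam → ‖coeff k (P + E)‖ ≤ (p : ℝ) ^ (-a) := by
    intro k a h1 h2
    rw [map_add]
    exact (Padic.nonarchimedean _ _).trans
      (max_le (norm_le_zpow_of_lt (hPk k) h1) (norm_le_zpow_of_lt (hEk k) h2))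
  refine ⟨fun k hk => ?_, fun k hk => ?_⟩
  · have hk1 : (0 : ℝ) ≤ (k : ℝ) - 1 := by
      have : (1 : ℝ) ≤ k := by exact_mod_cast hk
      linarith
    have h1 := mul_nonneg hk1 hμ0
    have h2 := mul_nonneg hk1 hlam0.le
    refine ⟨?_, ?_⟩
    · simpa using norm_le_zpow_of_lt (a := 0) (hPk k) (by push_cast; linarith)
    · exact norm_le_zpow_of_lt (a := 1) (hEk k) (by push_cast; linarith)
  · have hkR : (2 : ℝ) ≤ k := by exact_mod_cast hk
    -- the exponent `μ` is positive, as `ρ_p < 1` unless `p = 2`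
    have hμpos : 0 < μ := by
      rcases eq_or_ne p 2 with h | h
      · have : (3 : ℝ) ≤ κ := by exact_mod_cast hκ2 h
        linarith
      · have h3 : (3 : ℝ) ≤ p := by
          have := hp.two_le
          exact_mod_cast (show 3 ≤ p by omega)
        have : rho p < 1 := by nlinarith
        linarith
    have h1 : 0 < ((k : ℝ) - 1) * μ := mul_pos (by linarith) hμpos
    have h2 : 0 < ((k : ℝ) - 1) * lam := mul_pos (by linarith) hlam0
    refine ⟨hsum k 1 (by push_cast; linarith) (by push_cast; linarith), fun h => ?_,
      fun h e he => ?_⟩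
    · have hκ3 : (3 : ℝ) ≤ κ := by exact_mod_cast hκ2 h
      have hρe : rho p = 1 := by rw [rho, h]; norm_num
      have hμ2 : 2 ≤ μ := by linarith
      have hlam1 : 1 ≤ lam := by linarith
      have h3 : ((k : ℝ) - 1) * 2 ≤ ((k : ℝ) - 1) * μ :=
        mul_le_mul_of_nonneg_left hμ2 (by linarith)
      have h4 : ((k : ℝ) - 1) * 1 ≤ ((k : ℝ) - 1) * lam :=
        mul_le_mul_of_nonneg_left hlam1 (by linarith)
      have hmin : ((min k 3 : ℕ) : ℝ) ≤ k := by exact_mod_cast min_le_left k 3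
      refine hsum k _ ?_ ?_ <;> push_cast at hmin ⊢ <;> linarith
    · have h5 : (5 : ℝ) ≤ p := by exact_mod_cast h
      have hρ4 : rho p ≤ 1 / 4 := by nlinarith
      have hμ4 : 3 / 4 ≤ μ := by linarith
      have hbern : 1 + (e : ℝ) * ((p : ℝ) - 1) ≤ k := by
        have := one_add_mul_sub_le_pow (a := (p : ℝ)) (by linarith) e
        have h6 : ((p ^ e : ℕ) : ℝ) ≤ k := by exact_mod_cast he
        push_cast at h6
        linarith
      have he0 : (0 : ℝ) ≤ e := Nat.cast_nonneg e
      have h7 : (e : ℝ) * 4 ≤ e * ((p : ℝ) - 1) := mul_le_mul_of_nonneg_left (by linarith) he0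
      refine hsum k _ ?_ ?_
      · have h8 : ((k : ℝ) - 1) * (3 / 4) ≤ ((k : ℝ) - 1) * μ :=
          mul_le_mul_of_nonneg_left hμ4 (by linarith)
        push_cast
        rcases he0.eq_or_lt with h0 | h0
        · rw [← h0]; linarith
        · linarith
      · have h8 : ((k : ℝ) - 1) * rho p ≤ ((k : ℝ) - 1) * lam :=
          mul_le_mul_of_nonneg_left hlam (by linarith)
        have h9 : (e : ℝ) * ((p : ℝ) - 1) * rho p ≤ ((k : ℝ) - 1) * rho p :=
          mul_le_mul_of_nonneg_right (by linarith) hρ0.le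
        have h10 : (e : ℝ) * ((p : ℝ) - 1) * rho p = e := by
          rw [mul_assoc, mul_comm ((p : ℝ) - 1), hρ, mul_one]
        push_cast
        linarith

end Dual

/-! ### Decomposition of the phase and membership of its dual -/

section Membership

open PowerSeries Filter

variable {p : ℕ} [Fact p.Prime]

theorem norm_padicInt_unit (u : ℤ_[p]ˣ) : ‖((u : ℤ_[p]) : ℚ_[p])‖ = 1 := by
  rw [PadicInt.padic_norm_e_of_padicInt]
  exact PadicInt.norm_units u

theorem padicInt_unit_mul_inv (u : ℤ_[p]ˣ) :
    ((u : ℤ_[p]) : ℚ_[p]) * (((u⁻¹ : ℤ_[p]ˣ) : ℤ_[p]) : ℚ_[p]) = 1 := by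
  rw [← PadicInt.coe_mul, Units.mul_inv, PadicInt.coe_one]

theorem iota'_eq_iota_add (y : ℚ) : iota' p y = iota p y + padicValRat p y := by
  rw [iota, iota', padicValRat.inv]
  omega

omit [Fact p.Prime] in
theorem iota_inv (y : ℚ) : iota p y⁻¹ = iota' p y := by
  rw [iota, iota', inv_inv]

theorem max_one_norm_eq {y : ℚ} (hy : y ≠ 0) :
    max 1 ‖(y : ℚ_[p])‖ = (p : ℝ) ^ iota p y := by
  have hp1 : (1 : ℝ) < p := by exact_mod_cast (Fact.out : p.Prime).one_lt
  rw [norm_ratCast_eq hy, iota, padicValRat.inv]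
  rcases le_total 0 (-padicValRat p y) with h | h
  · rw [max_eq_right h, max_eq_right (one_le_zpow₀ hp1.le h)]
  · rw [max_eq_left h, max_eq_left (zpow_le_one_of_nonpos₀ hp1.le h), zpow_zero]

/-- The argument scale `p^{ι(y)+κ} ω` of the binomial series in the class `𝐅`. -/
noncomputable def argScale (κ : ℕ) (y : ℚ) (ω : ℤ_[p]ˣ) : ℚ_[p] :=
  (p : ℚ_[p]) ^ (iota p y + (κ : ℤ)) * ((ω : ℤ_[p]) : ℚ_[p])

theorem norm_argScale (κ : ℕ) (y : ℚ) (ω : ℤ_[p]ˣ) :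
    ‖argScale κ y ω‖ = (p : ℝ) ^ (-(iota p y + (κ : ℤ))) := by
  rw [argScale, norm_mul, norm_padicInt_unit, mul_one, Padic.norm_p_zpow]

theorem argScale_ne_zero (κ : ℕ) (y : ℚ) (ω : ℤ_[p]ˣ) : argScale κ y ω ≠ 0 := by
  have hp0 : (0 : ℝ) < p := by exact_mod_cast (Fact.out : p.Prime).pos
  rw [← norm_ne_zero_iff, norm_argScale]
  positivity

theorem gaussBound_binomialMap_argScale {y : ℚ} (hy : y ≠ 0) (κ : ℕ) (ω ω' : ℤ_[p]ˣ) {t : ℝ}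
    (ht : t ≤ (κ : ℝ) - rhoY p y) :
    GaussBound ((p : ℝ) ^ t) ((p : ℝ) ^ t)
      (binomialMap (argScale κ y ω) (argScale κ y⁻¹ ω') (-y)) := by
  have hp0 : (0 : ℝ) < p := by exact_mod_cast (Fact.out : p.Prime).pos
  have hp1 : (1 : ℝ) < p := by exact_mod_cast (Fact.out : p.Prime).one_lt
  refine gaussBound_binomialMap (κ := κ) (neg_ne_zero.2 hy) ?_ ?_ (by positivity) ?_
  · rw [Rat.cast_neg, norm_neg, max_one_norm_eq hy, norm_argScale, ← zpow_add₀ hp0.ne']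
    congr 1
    ring
  · rw [Rat.cast_neg, norm_neg, norm_argScale, norm_argScale, norm_ratCast_eq hy,
      ← zpow_add₀ hp0.ne', iota_inv, iota'_eq_iota_add]
    congr 1
    ring
  · rw [rhoY_neg]
    exact Real.rpow_le_rpow_of_exponent_le hp1.le ht

theorem norm_coeff_one_binomialMap {y : ℚ} (hy : y ≠ 0) (κ : ℕ) (ω ω' : ℤ_[p]ˣ) :
    ‖coeff 1 (binomialMap (argScale κ y ω) (argScale κ y⁻¹ ω') (-y))‖ = 1 := by
  have hp0 : (0 : ℝ) < p := by exact_mod_cast (Fact.out : p.Prime).pos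
  rw [binomialMap, coeff_C_mul, map_sub, coeff_onePlusPow, coeff_one, if_neg one_ne_zero, sub_zero,
    pow_one, Ring.choose_one_right, norm_mul, norm_mul, norm_inv, norm_argScale, norm_argScale,
    Rat.cast_neg, norm_neg, norm_ratCast_eq hy, iota_inv, iota'_eq_iota_add, ← zpow_neg,
    ← zpow_add₀ hp0.ne', ← zpow_add₀ hp0.ne']
  rw [← zpow_zero (p : ℝ)]
  congr 1
  ring

/-- The error term `p^k (g - g(0))` with `g ∈ 𝐈₀[λ](ℤ_p)` on discs of radius at most `p^λ`. -/
theorem gaussBound_error {lam t : ℝ} (ht : t ≤ lam) {g : ℚ_[p]⟦X⟧} (hg : g ∈ I0Lam p lam) (k : ℤ) :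
    GaussBound ((p : ℝ) ^ t) ((p : ℝ) ^ (-((k + ⌊lam⌋ : ℤ) : ℝ)) * (p : ℝ) ^ t)
      (C ((p : ℚ_[p]) ^ k) * (g - C (constantCoeff g))) := by
  have hp0 : (0 : ℝ) < p := by exact_mod_cast (Fact.out : p.Prime).pos
  have hp1 : (1 : ℝ) < p := by exact_mod_cast (Fact.out : p.Prime).one_lt
  intro i
  rcases Nat.eq_zero_or_pos i with rfl | hi
  · rw [coeff_C_mul, map_sub, coeff_C, if_pos rfl, coeff_zero_eq_constantCoeff_apply, sub_self,
      mul_zero, norm_zero, zero_mul]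
    positivity
  · rw [coeff_C_mul, map_sub, coeff_C, if_neg hi.ne', sub_zero, norm_mul, Padic.norm_p_zpow]
    have h1 := (gaussBound_of_mem_I0Lam hg).norm_coeff_le i
    rw [one_mul] at h1
    have hi1 : (0 : ℝ) ≤ (i : ℝ) - 1 := by
      have : (1 : ℝ) ≤ i := by exact_mod_cast hi
      linarith
    have h2 : ((i : ℝ) - 1) * t ≤ ((i : ℝ) - 1) * lam := mul_le_mul_of_nonneg_left ht hi1
    have h3 := Int.floor_le lam
    calc _ ≤ (p : ℝ) ^ (-k) * (p : ℝ) ^ (-((i : ℝ) * lam)) * ((p : ℝ) ^ t) ^ i := by gcongr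
      _ = (p : ℝ) ^ (-(k : ℝ) + -((i : ℝ) * lam) + t * i) := by
          rw [← Real.rpow_mul_natCast hp0.le, ← Real.rpow_intCast, ← Real.rpow_add hp0,
            ← Real.rpow_add hp0]
          push_cast
          ring_nf
      _ ≤ (p : ℝ) ^ (-((k + ⌊lam⌋ : ℤ) : ℝ) + t) := by
          apply Real.rpow_le_rpow_of_exponent_le hp1.le
          push_cast
          linarith
      _ = _ := Real.rpow_add hp0 _ _

/-- For `f` in the class, `f' = f'(0) + p^v (P + E)` with a normalised binomial series `P` and a
small error `E`. -/
theorem InClassF.derivative_eq {w : ℤ} {y : ℚ} {κ : ℕ} {lam : ℝ} {u : ℤ} {ω ω' : ℤ_[p]ˣ}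
    {f : ℚ_[p]⟦X⟧} (hf : InClassF p w y κ lam u ω ω' f) :
    ∃ g ∈ I0Lam p lam, derivative ℚ_[p] f = C (constantCoeff (derivative ℚ_[p] f)) +
      C ((p : ℚ_[p]) ^ (w + κ + iota' p y)) *
        (binomialMap (argScale κ y ω) (argScale κ y⁻¹ ω'⁻¹) (-y) +
          C ((p : ℚ_[p]) ^ (u - κ - iota' p y)) * (g - C (constantCoeff g))) := by
  have hpQ : (p : ℚ_[p]) ≠ 0 := by exact_mod_cast (Fact.out : p.Prime).ne_zero
  obtain ⟨γ₀, g, hg, hd⟩ := hf.deriv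
  refine ⟨g, hg, ?_⟩
  rw [← argScale] at hd
  have h1 : (p : ℚ_[p]) ^ (w + κ + iota' p y) * (argScale κ y⁻¹ ω'⁻¹)⁻¹ =
      (p : ℚ_[p]) ^ w * ((ω' : ℤ_[p]) : ℚ_[p]) := by
    rw [eq_comm, eq_mul_inv_iff_mul_eq₀ (argScale_ne_zero _ _ _), argScale, iota_inv]
    have h3 := padicInt_unit_mul_inv ω'
    have h4 : (p : ℚ_[p]) ^ (w + κ + iota' p y) =
        (p : ℚ_[p]) ^ w * (p : ℚ_[p]) ^ (iota' p y + (κ : ℤ)) := by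
      rw [← zpow_add₀ hpQ]; congr 1; ring
    rw [h4]
    linear_combination (p : ℚ_[p]) ^ w * (p : ℚ_[p]) ^ (iota' p y + (κ : ℤ)) * h3
  have h2 : (p : ℚ_[p]) ^ (w + κ + iota' p y) * (p : ℚ_[p]) ^ (u - κ - iota' p y) =
      (p : ℚ_[p]) ^ (u + w) := by
    rw [← zpow_add₀ hpQ]; congr 1; ring
  have h1C := congrArg (C : ℚ_[p] → ℚ_[p]⟦X⟧) h1
  have h2C := congrArg (C : ℚ_[p] → ℚ_[p]⟦X⟧) h2
  rw [map_mul] at h1C h2C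
  rw [hd, binomialMap]
  simp only [map_add, map_mul, constantCoeff_C, constantCoeff_onePlusPow, mul_one]
  simp only [map_mul] at h1C
  linear_combination (-(onePlusPow p (argScale κ y ω) (-y) - 1)) * h1C -
    (g - C (constantCoeff g)) * h2C

/-- The dual of a series in the class `𝐅` is in the dual class. -/
theorem InClassF.dual {w : ℤ} {y : ℚ} {κ : ℕ} {lam : ℝ} {u : ℤ} {ω ω' : ℤ_[p]ˣ}
    {f φ E : ℚ_[p]⟦X⟧} (hf : InClassF p w y κ lam u ω ω' f)
    (hu : (κ : ℤ) + iota' p y < u + ⌊lam⌋) (hpos : 0 < lamTilde p y κ lam)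
    (hE : GaussBound ((p : ℝ) ^ lamTilde p y κ lam)
      ((p : ℝ) ^ (-((u - κ - iota' p y + ⌊lam⌋ : ℤ) : ℝ)) * (p : ℝ) ^ lamTilde p y κ lam) E)
    (hE0 : constantCoeff E = 0)
    (hφ : GaussBound ((p : ℝ) ^ lamTilde p y κ lam) ((p : ℝ) ^ lamTilde p y κ lam) φ)
    (hφ0 : constantCoeff φ = 0)
    (hφG : (binomialMap (argScale κ y ω) (argScale κ y⁻¹ ω'⁻¹) (-y) + E).subst φ =
      PowerSeries.X) :
    InClassF p (w + padicValRat p y) y⁻¹ κ (lamTilde p y κ lam)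
      (u + (⌊lam⌋ - ⌈lamTilde p y κ lam⌉) - padicValRat p y) ω'⁻¹ (-ω⁻¹)
      (C (constantCoeff f) - C ((p : ℚ_[p]) ^ (w + κ + iota' p y)) * antiderivative φ) := by
  have hp0 : (0 : ℝ) < p := by exact_mod_cast (Fact.out : p.Prime).pos
  have hp1 : (1 : ℝ) < p := by exact_mod_cast (Fact.out : p.Prime).one_lt
  have hpQ : (p : ℚ_[p]) ≠ 0 := by exact_mod_cast (Fact.out : p.Prime).ne_zero
  have hy : y ≠ 0 := hf.y_pos.ne'
  set lt := lamTilde p y κ lam with hlt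
  have hltκ : lt ≤ (κ : ℝ) - rhoY p y := min_le_left _ _
  have hr : 1 < (p : ℝ) ^ lt := Real.one_lt_rpow hp1 hpos
  set c₁ := argScale κ y ω with hc₁
  set c₂ := argScale κ y⁻¹ ω'⁻¹ with hc₂
  set Q := binomialMap c₂ c₁ (-y)⁻¹ with hQdef
  have hQ : GaussBound ((p : ℝ) ^ lt) ((p : ℝ) ^ lt) Q := by
    have h := gaussBound_binomialMap_argScale (inv_ne_zero hy) κ ω'⁻¹ ω (t := lt)
      (by rw [rhoY_inv]; exact hltκ)
    rw [inv_inv] at h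
    rwa [hQdef, inv_neg]
  have hQP : Q.subst (binomialMap c₁ c₂ (-y)) = PowerSeries.X :=
    binomialMap_subst_binomialMap (argScale_ne_zero _ _ _) (argScale_ne_zero _ _ _)
      (neg_ne_zero.2 hy)
  have hs : (1 : ℤ) ≤ u - κ - iota' p y + ⌊lam⌋ := by omega
  have hle : (p : ℝ) ^ (-((u - κ - iota' p y + ⌊lam⌋ : ℤ) : ℝ)) * (p : ℝ) ^ lt ≤ (p : ℝ) ^ lt := by
    refine mul_le_of_le_one_left (by positivity) ?_
    apply Real.rpow_le_one_of_one_le_of_nonpos hp1.le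
    have : (1 : ℝ) ≤ ((u - κ - iota' p y + ⌊lam⌋ : ℤ) : ℝ) := by exact_mod_cast hs
    linarith
  have hdiff := GaussBound.inverse_sub_inverse (by positivity) hle
    (constantCoeff_binomialMap c₁ c₂ (-y)) hE0 hφ0 hφ hQ hE hQP hφG
  have hvw : w + κ + iota' p y = (w + padicValRat p y) + (iota p y + κ) := by
    rw [iota'_eq_iota_add]; ring
  have hceil : lt ≤ ⌈lt⌉ := Int.le_ceil lt
  have hceilκ : ⌈lt⌉ ≤ (κ : ℤ) := by
    apply Int.ceil_le.2
    have : 0 ≤ rhoY p y := by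
      rw [rhoY]; split_ifs
      · exact le_rfl
      · exact rho_pos.le
    push_cast
    linarith
  have hιval : padicValRat p y ≤ iota' p y := le_max_right _ _
  refine ⟨inv_pos.2 hf.y_pos, hf.kappa_ge, by omega, lamTilde_eq_mul_rho hf.lam_mem hpos, ?_,
    ((ω⁻¹ : ℤ_[p]ˣ) : ℤ_[p]), ?_⟩
  · apply Restricted.exists_eq_C_mul
    rw [sub_eq_add_neg, ← neg_mul, ← map_neg]
    exact (Restricted.C _).add ((Restricted.C _).mul (hφ.tendsto_antiderivative hr))
  set u' := u + (⌊lam⌋ - ⌈lt⌉) - padicValRat p y with hu'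
  set w' := w + padicValRat p y with hw'
  refine ⟨C (-(p : ℚ_[p]) ^ (w + κ + iota' p y - (u' + w'))) * (φ - Q), ?_, ?_⟩
  · apply mem_I0Lam_of_gaussBound hpos
    refine (hdiff.C_mul _).mono ?_
    rw [norm_neg, Padic.norm_p_zpow, ← Real.rpow_intCast, ← Real.rpow_add hp0, ← Real.rpow_add hp0]
    apply Real.rpow_le_one_of_one_le_of_nonpos hp1.le
    rw [hu', hw']
    push_cast
    linarith
  · have hω := padicInt_unit_mul_inv ω
    have hc : (p : ℚ_[p]) ^ (w + κ + iota' p y) * c₁⁻¹ =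
        (p : ℚ_[p]) ^ w' * (((ω⁻¹ : ℤ_[p]ˣ) : ℤ_[p]) : ℚ_[p]) := by
      rw [eq_comm, eq_mul_inv_iff_mul_eq₀ (argScale_ne_zero _ _ _), argScale, hvw,
        zpow_add₀ hpQ w']
      linear_combination (p : ℚ_[p]) ^ w' * (p : ℚ_[p]) ^ (iota p y + (κ : ℤ)) * hω
    have hp2 : (p : ℚ_[p]) ^ (u' + w') * (p : ℚ_[p]) ^ (w + κ + iota' p y - (u' + w')) =
        (p : ℚ_[p]) ^ (w + κ + iota' p y) := by
      rw [← zpow_add₀ hpQ]; congr 1; ring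
    have hcC := congrArg (C : ℚ_[p] → ℚ_[p]⟦X⟧) hc
    have hpC := congrArg (C : ℚ_[p] → ℚ_[p]⟦X⟧) hp2
    rw [← argScale, ← hc₂, ← inv_neg (a := y), map_sub, Derivation.leibniz, derivative_C,
      derivative_C, derivative_antiderivative]
    have hQ' : Q = C c₁⁻¹ * (onePlusPow p c₂ (-y)⁻¹ - 1) := rfl
    rw [hQ']
    simp only [map_mul, map_neg, Units.val_neg, PadicInt.coe_neg, smul_eq_mul, zero_sub]
      at hcC hpC ⊢
    linear_combination (φ - C c₁⁻¹ * (onePlusPow p c₂ (-y)⁻¹ - 1)) * hpC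
      - (onePlusPow p c₂ (-y)⁻¹ - 1) * hcC

end Membership

end PadicPhase

theorem mainTheorem5 (p : ℕ) [Fact p.Prime] (f : ℚ_[p]⟦X⟧) :
    ∃ fd : ℚ_[p]⟦X⟧,
      ∀ (w : ℤ) (y : ℚ) (κ : ℕ) (lam : ℝ) (u : ℤ) (ω ω' : ℤ_[p]ˣ),
        PadicPhase.InClassF p w y κ lam u ω ω' f →
        1 + PadicPhase.iota' p 4 ≤ (κ : ℤ) →
        (κ : ℤ) + PadicPhase.iota' p y < u + ⌊lam⌋ →
        0 < PadicPhase.lamTilde p y κ lam →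
        PadicPhase.InClassF p (w + padicValRat p y) y⁻¹ κ (PadicPhase.lamTilde p y κ lam)
          (u + (⌊lam⌋ - ⌈PadicPhase.lamTilde p y κ lam⌉) - padicValRat p y) ω'⁻¹ (-ω⁻¹) fd ∧
        ∀ n : ℕ, 0 < n →
          (κ : ℤ) + PadicPhase.iota' p y + PadicPhase.iota' p 12 < (n : ℤ) - w →
          ∃ ε : ℂ, ‖ε‖ = 1 ∧
            ∀ (B : ℝ), 0 < B → ∀ (h : 𝓢(ℝ, ℂ)) (a : ℚ), PadicPhase.IsPFraction p a →
              ‖(a : ℚ_[p]) - PowerSeries.constantCoeff (PowerSeries.derivative ℚ_[p] f)‖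
                ≤ (p : ℝ) ^ (-(n : ℤ)) →
              Summable (fun m : ℤ =>
                PadicPhase.eP p (PadicPhase.evalAt p f (m : ℚ_[p]) / (p : ℚ_[p]) ^ n) *
                  h ((m : ℝ) / B)) ∧
              Summable (fun t : ℤ =>
                PadicPhase.eP p (PadicPhase.evalAt p fd (t : ℚ_[p]) / (p : ℚ_[p]) ^ n) *
                  PadicPhase.hHat p h a n B
                    ((t : ℝ) / ((p : ℝ) ^ ((n : ℤ) - w - PadicPhase.iota' p y - κ) / B))) ∧
              ∑' m : ℤ,
                  PadicPhase.eP p (PadicPhase.evalAt p f (m : ℚ_[p]) / (p : ℚ_[p]) ^ n) *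
                    h ((m : ℝ) / B) =
                ε * (B : ℂ) /
                    (((p : ℝ) ^ (((n : ℝ) - w - (PadicPhase.iota' p y : ℝ) - κ) / 2) : ℝ) : ℂ) *
                  ∑' t : ℤ,
                    PadicPhase.eP p (PadicPhase.evalAt p fd (t : ℚ_[p]) / (p : ℚ_[p]) ^ n) *
                      PadicPhase.hHat p h a n B
                        ((t : ℝ) /
                          ((p : ℝ) ^ ((n : ℤ) - w - PadicPhase.iota' p y - κ) / B)) := by
  open PadicPhase PowerSeries in
  refine ⟨dualSeries f, fun w y κ lam u ω ω' hf hκ4 hu hpos => ?_⟩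
  have hp := (Fact.out : p.Prime)
  have hp1 : (1 : ℝ) < p := by exact_mod_cast hp.one_lt
  have hy : y ≠ 0 := hf.y_pos.ne'
  have hltκ : lamTilde p y κ lam ≤ (κ : ℝ) - rhoY p y := min_le_left _ _
  have hltlam : lamTilde p y κ lam ≤ lam := min_le_right _ _
  have hι : ∀ q : ℚ, 0 ≤ iota' p q := fun q => le_max_left _ _
  have hκ1 : 1 ≤ κ := by have := hι 4; omega
  have hκ2 : p = 2 → 3 ≤ κ := by
    intro h
    have := le_iota'_natCast (p := p) (m := 4) (j := 2) (by norm_num) (by rw [h]; norm_num)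
    norm_num at this
    omega
  have hlamρ : rho p ≤ lam := by
    obtain ⟨k, hk, rfl⟩ := hf.lam_mem
    exact le_mul_of_one_le_left rho_pos.le (by exact_mod_cast hk)
  obtain ⟨g, hg, hd⟩ := hf.derivative_eq
  set P := binomialMap (argScale κ y ω) (argScale κ y⁻¹ ω'⁻¹) (-y) with hPdef
  set E := C ((p : ℚ_[p]) ^ (u - κ - iota' p y)) * (g - C (constantCoeff g)) with hEdef
  have hE0 : constantCoeff E = 0 := by simp [hEdef]
  have hP0 : constantCoeff P = 0 := constantCoeff_binomialMap _ _ _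
  have hs : (1 : ℤ) ≤ u - κ - iota' p y + ⌊lam⌋ := by omega
  obtain ⟨hcoef, htame⟩ := tameCoeffs_add (p := p) (κ := κ) (μ := (κ : ℝ) - rhoY p y)
    (by linarith [rhoY_le_rho (p := p) y]) hκ1 hκ2 hlamρ hs
    (gaussBound_binomialMap_argScale hy κ ω ω'⁻¹ le_rfl) (gaussBound_error le_rfl hg _)
  rw [← hPdef, ← hEdef] at htame
  have hG0 : constantCoeff (P + E) = 0 := by rw [map_add, hP0, hE0, add_zero]
  have hG1 : ‖coeff 1 (P + E)‖ = 1 := by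
    have h1 : ‖coeff 1 P‖ = 1 := norm_coeff_one_binomialMap hy κ ω ω'⁻¹
    have h2 : ‖coeff 1 E‖ < 1 := by
      refine (hcoef 1 le_rfl).2.trans_lt ?_
      rw [zpow_neg_one]
      exact inv_lt_one_of_one_lt₀ hp1
    rw [map_add, IsUltrametricDist.norm_add_eq_max_of_norm_ne_norm (by rw [h1]; exact h2.ne'), h1,
      max_eq_left h2.le]
  have hEr := gaussBound_error hltlam hg (u - κ - iota' p y)
  have hGr : GaussBound ((p : ℝ) ^ lamTilde p y κ lam) ((p : ℝ) ^ lamTilde p y κ lam) (P + E) := by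
    refine GaussBound.add (by positivity)
      (gaussBound_binomialMap_argScale hy κ ω ω'⁻¹ hltκ) (hEr.mono ?_)
    refine mul_le_of_le_one_left (by positivity) ?_
    apply Real.rpow_le_one_of_one_le_of_nonpos hp1.le
    have : (1 : ℝ) ≤ ((u - κ - iota' p y + ⌊lam⌋ : ℤ) : ℝ) := by exact_mod_cast hs
    linarith
  have hr : 1 < (p : ℝ) ^ lamTilde p y κ lam := Real.one_lt_rpow hp1 hpos
  have hunit : IsUnit (coeff 1 (P + E)) := by
    rw [isUnit_iff_ne_zero, ← norm_ne_zero_iff, hG1]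
    exact one_ne_zero
  obtain ⟨φ, hφ0, hGφ, hφG, hfd⟩ : ∃ φ : ℚ_[p]⟦X⟧, constantCoeff φ = 0 ∧
      (P + E).subst φ = PowerSeries.X ∧ φ.subst (P + E) = PowerSeries.X ∧
      dualSeries f = C (constantCoeff f) -
        C ((p : ℚ_[p]) ^ (w + κ + iota' p y)) * antiderivative φ := by
    refine ⟨(P + E).substInvOfIsUnit hunit, by simp, subst_substInvOfIsUnit_right _ hG0 hunit,
      subst_substInvOfIsUnit_left _ hG0 hunit, ?_⟩
    have hn := normalizedDerivative_eq hG1 hd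
    rw [dualSeries, dif_pos (by rw [hn]; exact hunit), phaseExponent_eq hG1 hd]
    congr!
  have hφr := GaussBound.of_subst_eq_X (by positivity) hG0 hG1 hGr hφG
  rw [hfd]
  -- the factor `12` in the bound for `n - w` provides `N ≥ 3` for `p = 2` and `N ≥ 2` for `p = 3`
  refine ⟨hf.dual hu hpos hEr hE0 hφr hφ0 hGφ, fun n _ hn => ?_⟩
  have h12 := hι 12
  obtain ⟨N, hN⟩ : ∃ N : ℕ, (N : ℤ) = n - (w + κ + iota' p y) :=
    ⟨_, Int.toNat_of_nonneg (by omega)⟩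
  have e1 : (n : ℤ) - w - iota' p y - κ = N := by rw [hN]; ring
  have e2 : (n : ℝ) - w - (iota' p y : ℝ) - κ = N := by exact_mod_cast e1
  rw [e1, e2]
  refine summation_formula hr hd hGr hG0 hG1 htame hφr hφ0 hGφ hN (by omega) ?_ ?_
  · intro h
    have := le_iota'_natCast (p := p) (m := 12) (j := 2) (by norm_num) (by rw [h]; norm_num)
    norm_num at this
    omega
  · intro h
    have := le_iota'_natCast (p := p) (m := 12) (j := 1) (by norm_num) (by rw [h]; norm_num)
    norm_num at this
    omega
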